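/- Let $S$ be a finite set of $n\ge 4$ points in the Euclidean plane, no three of which are collinear. Let $M$ be a Euclidean minimum spanning tree of $S$, i.e. a spanning tree of the complete graph on $S$ whose total Euclidean edge length is minimum. For a graph $G$ with vertex set $S$, whose edges are drawn as straight-line segments, write $\mathrm{BE}(G)$ for the Euclidean length of a longest edge of $G$, and call $G$ plane if any two distinct edges meet at most in a common endpoint. Then there exist two plane spanning trees $R=(S,E_R)$ and $B=(S,E_B)$ on $S$ such that $E_R\cap E_B=\emptyset$, $$\max\{\mathrm{BE}(R),\mathrm{BE}(B)\}\le 3\,\mathrm{BE}(M),$$ and at most one edge of $E_R\cup E_B$ has length greater than $2\,\mathrm{BE}(M)$. -/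

import Mathlib

namespace PlaneLayers

/-- The Euclidean plane. -/
abbrev Plane : Type := EuclideanSpace ℝ (Fin 2)

/-- No three distinct points of `S` are collinear. -/
def GeneralPosition (S : Finset Plane) : Prop :=
  ∀ a ∈ S, ∀ b ∈ S, ∀ c ∈ S, a ≠ b → a ≠ c → b ≠ c → ¬ Collinear ℝ ({a, b, c} : Set Plane)

variable {S : Finset Plane}

/-- The Euclidean length of the straight edge joining two points of `S`. -/
noncomputable def edgeLength (e : Sym2 S) : ℝ :=
  Sym2.lift ⟨fun u v : S => dist (u : Plane) (v : Plane), fun _ _ => dist_comm _ _⟩ e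

/-- A graph on the point set `S`, drawn with straight-line edges, is plane if two distinct edges
meet at most in a common endpoint. -/
def IsPlane (G : SimpleGraph S) : Prop :=
  ∀ a b c d : S, G.Adj a b → G.Adj c d → s(a, b) ≠ s(c, d) →
    segment ℝ (a : Plane) (b : Plane) ∩ segment ℝ (c : Plane) (d : Plane) ⊆
      ({(a : Plane), (b : Plane)} ∩ {(c : Plane), (d : Plane)} : Set Plane)

/-- The length of a longest edge of `G`. (The set of edge lengths is finite; the value is `0` if `G`
has no edges.) -/
noncomputable def bottleneck (G : SimpleGraph S) : ℝ :=
  sSup (edgeLength '' G.edgeSet)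

open Classical in
/-- The sum of the lengths of the edges of `G`. -/
noncomputable def totalLength (G : SimpleGraph S) : ℝ :=
  ∑ e ∈ G.edgeFinset, edgeLength e

/-- `M` is a Euclidean minimum spanning tree of `S`: a spanning tree of the complete graph on `S`
of minimum total edge length. -/
def IsMST (M : SimpleGraph S) : Prop :=
  M.IsTree ∧ ∀ T : SimpleGraph S, T.IsTree → totalLength M ≤ totalLength T

end PlaneLayers

/-! Besides being a tree, $M$ is used only through one property, obtained by edge exchange
(`IsMST.luneFree`): no point of $S$ lies in the open lune of an edge. Hence edges of $M$ do not
cross, and the triangle spanned by two edges at a common vertex contains no further point of $S$. It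
follows that a chord between angularly consecutive neighbours of a vertex (a `Gap`) crosses no edge
of $M$, and that it can cross a chord around $w$ only if $w$ is one of its own ends.

Root $M$ at a leaf $r$ and split by parity of depth: `layer M r 0` takes the tree edges with upper
end at even depth and the gaps around odd vertices, `layer M r 1` does the opposite. The ends of a
gap have the parity opposite to its centre, which makes the layers non-crossing and edge-disjoint;
their edges have length at most $2\,\mathrm{BE}(M)$. The gaps around a vertex connect all its
neighbours, so in either layer a vertex reaches its parent by a tree edge or its grandparent by
gaps. Thus layer 0 is connected, and layer 1 connects everything except $r$, which is isolated in
it.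

It remains to attach $r$ to layer 1. Choose $r$ at a vertex $c$ with at most one non-leaf neighbour
(`exists_leaf_cluster`). If two leaves at $c$ are angularly consecutive and followed by a third
neighbour, exchanging chords at $c$ suffices and no edge exceeds $2\,\mathrm{BE}(M)$. Otherwise
follow a path $r\,c\,g\,x$: `exists_visible` finds a point of a triangle with vertices $r$ and $x$
that $r$ can be joined to without crossings, at distance at most $3\,\mathrm{BE}(M)$. This is the
only possibly long edge. It works directly when $x$ and $r$ lie on the same side of $cg$; if all
further neighbours of $g$ are on the other side and $c$ has degree two, $rg$ and $cg$ first change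
layers. -/

namespace PlaneLayers

/-! ### Orientation, wedges and triangles -/

/-- Twice the signed area of the triangle `p q r`. -/
noncomputable def orient (p q r : Plane) : ℝ :=
  (q 0 - p 0) * (r 1 - p 1) - (q 1 - p 1) * (r 0 - p 0)

/-- `w` lies in the open convex wedge with apex `v` spanned by `a` and `b`. -/
def InWedge (v a b w : Plane) : Prop :=
  0 < orient v w b * orient v a b ∧ 0 < orient v a w * orient v a b

/-- The closed triangle with vertices `p`, `q`, `r`. -/
def triangle (p q r : Plane) : Set Plane :=
  {x | ∃ α β γ : ℝ, 0 ≤ α ∧ 0 ≤ β ∧ 0 ≤ γ ∧ α + β + γ = 1 ∧ x = α • p + β • q + γ • r}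

lemma plane_ext {x y : Plane} (h0 : x 0 = y 0) (h1 : x 1 = y 1) : x = y := by
  ext i; fin_cases i
  · exact h0
  · exact h1

lemma mem_segment_coord {a b z : Plane} :
    z ∈ segment ℝ a b ↔ ∃ t : ℝ, 0 ≤ t ∧ t ≤ 1 ∧ z 0 = (1 - t) * a 0 + t * b 0 ∧
      z 1 = (1 - t) * a 1 + t * b 1 := by
  constructor
  · rintro ⟨s, t, hs, ht, hst, rfl⟩
    refine ⟨t, ht, by linarith, ?_, ?_⟩ <;> simp [← hst]
  · rintro ⟨t, h0, h1, hx, hy⟩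
    refine ⟨1 - t, t, by linarith, h0, by ring, plane_ext ?_ ?_⟩
    · simp [hx]
    · simp [hy]

lemma mem_triangle_coord {p q r x : Plane} :
    x ∈ triangle p q r ↔ ∃ α β γ : ℝ, 0 ≤ α ∧ 0 ≤ β ∧ 0 ≤ γ ∧ α + β + γ = 1 ∧
      x 0 = α * p 0 + β * q 0 + γ * r 0 ∧ x 1 = α * p 1 + β * q 1 + γ * r 1 := by
  constructor
  · rintro ⟨α, β, γ, ha, hb, hc, h, rfl⟩
    exact ⟨α, β, γ, ha, hb, hc, h, by simp, by simp⟩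
  · rintro ⟨α, β, γ, ha, hb, hc, h, h0, h1⟩
    exact ⟨α, β, γ, ha, hb, hc, h, plane_ext (by simp [h0]) (by simp [h1])⟩

lemma orient_swap (p q r : Plane) : orient p r q = -orient p q r := by
  unfold orient; ring

lemma orient_rotate (p q r : Plane) : orient q r p = orient p q r := by
  unfold orient; ring

lemma collinear_of_orient_eq_zero {a b c : Plane} (h : orient a b c = 0) :
    Collinear ℝ ({a, b, c} : Set Plane) := by
  by_cases hab : a = b
  · subst hab; simpa using collinear_pair ℝ a c
  · rw [collinear_iff_of_mem (p₀ := a) (by simp)]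
    refine ⟨b - a, ?_⟩
    have hne : b 0 - a 0 ≠ 0 ∨ b 1 - a 1 ≠ 0 := by
      by_contra! hcon
      exact hab (plane_ext (by linarith [hcon.1]) (by linarith [hcon.2]))
    unfold orient at h
    have hc : ∃ t : ℝ, c = t • (b - a) +ᵥ a := by
      rcases hne with hne | hne
      · refine ⟨(c 0 - a 0) / (b 0 - a 0), plane_ext ?_ ?_⟩
        · simp; field_simp; ring
        · simp; field_simp; linarith
      · refine ⟨(c 1 - a 1) / (b 1 - a 1), plane_ext ?_ ?_⟩
        · simp; field_simp; linarith
        · simp; field_simp; ring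
    intro p hp
    simp only [Set.mem_insert_iff, Set.mem_singleton_iff] at hp
    rcases hp with rfl | rfl | rfl
    · exact ⟨0, by simp⟩
    · exact ⟨1, by simp⟩
    · exact hc

lemma InWedge.symm {v a b w : Plane} (h : InWedge v a b w) : InWedge v b a w := by
  obtain ⟨h1, h2⟩ := h
  refine ⟨?_, ?_⟩
  · rw [orient_swap v a w, orient_swap v a b]; linarith
  · rw [orient_swap v w b, orient_swap v a b]; linarith

/-- The Grassmann–Plücker relation for vectors based at $v$; it turns nesting of wedges into a sign
computation. -/
lemma plucker (v a u w b : Plane) :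
    orient v a w * orient v u b = orient v a u * orient v w b + orient v u w * orient v a b := by
  unfold orient; ring

lemma InWedge.pos_or_neg {v a b w : Plane} (h : InWedge v a b w) :
    (0 < orient v a b ∧ 0 < orient v w b ∧ 0 < orient v a w) ∨
      (orient v a b < 0 ∧ orient v w b < 0 ∧ orient v a w < 0) := by
  obtain ⟨h1, h2⟩ := h
  rcases pos_and_pos_or_neg_and_neg_of_mul_pos h1 with ⟨ha, hb⟩ | ⟨ha, hb⟩
  · exact Or.inl ⟨hb, ha, pos_of_mul_pos_left h2 hb.le⟩
  · exact Or.inr ⟨hb, ha, neg_of_mul_pos_left h2 hb.le⟩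

lemma InWedge.trans {v a b w u : Plane} (hw : InWedge v a b w) (hu : InWedge v a w u) :
    InWedge v a b u := by
  have hp := plucker v a u w b
  rcases hw.pos_or_neg with ⟨h1, h2, h3⟩ | ⟨h1, h2, h3⟩ <;>
    rcases hu.pos_or_neg with ⟨g1, g2, g3⟩ | ⟨g1, g2, g3⟩ <;> try linarith
  · have : 0 < orient v u b := by
      have : 0 < orient v a w * orient v u b := by rw [hp]; positivity
      exact pos_of_mul_pos_right this h3.le
    exact ⟨by positivity, by positivity⟩
  · have : orient v u b < 0 := by
      have : 0 < orient v a w * orient v u b := by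
        rw [hp]; exact add_pos (mul_pos_of_neg_of_neg g3 h2) (mul_pos_of_neg_of_neg g2 h1)
      exact neg_of_mul_pos_right this h3.le
    exact ⟨mul_pos_of_neg_of_neg this h1, mul_pos_of_neg_of_neg g3 h1⟩

lemma not_inWedge_self_right (v a b : Plane) : ¬ InWedge v a b b := by
  rintro ⟨h, -⟩
  have : orient v b b = 0 := by unfold orient; ring
  simp [this] at h

lemma not_inWedge_self_left (v a b : Plane) : ¬ InWedge v a b a := fun h =>
  not_inWedge_self_right v b a h.symm

lemma inWedge_or_of_inWedge {v a b w u : Plane} (hw : InWedge v a b w) (hu : InWedge v a b u)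
    (hne : orient v w u ≠ 0) : InWedge v a w u ∨ InWedge v w b u := by
  unfold InWedge
  rcases hw.pos_or_neg with ⟨h1, h2, h3⟩ | ⟨h1, h2, h3⟩ <;>
    rcases hu.pos_or_neg with ⟨g1, g2, g3⟩ | ⟨g1, g2, g3⟩ <;> try linarith
  · rcases lt_or_gt_of_ne hne with h | h
    · left
      have := orient_swap v w u
      exact ⟨mul_pos (by linarith) h3, by positivity⟩
    · right; exact ⟨by positivity, by positivity⟩
  · rcases lt_or_gt_of_ne hne with h | h
    · right; exact ⟨mul_pos_of_neg_of_neg g2 h2, mul_pos_of_neg_of_neg h h2⟩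
    · left
      have := orient_swap v w u
      exact ⟨mul_pos_of_neg_of_neg (by linarith) h3, mul_pos_of_neg_of_neg g3 h3⟩

/-- Two points on the same side of the line `v g`: one lies in the wedge spanned by `g` and the
other. -/
lemma inWedge_or_of_same_side {v g a b : Plane} (h : 0 < orient v g a * orient v g b)
    (hne : orient v a b ≠ 0) : InWedge v g a b ∨ InWedge v g b a := by
  unfold InWedge
  have hs := orient_swap v a b
  rcases pos_and_pos_or_neg_and_neg_of_mul_pos h with ⟨ha, hb⟩ | ⟨ha, hb⟩ <;>
    rcases lt_or_gt_of_ne hne with h' | h'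
  · left; exact ⟨mul_pos (by linarith) ha, by positivity⟩
  · right; exact ⟨by positivity, by positivity⟩
  · right; exact ⟨mul_pos_of_neg_of_neg h' hb, mul_pos_of_neg_of_neg ha hb⟩
  · left; exact ⟨mul_pos_of_neg_of_neg (by linarith) ha, mul_pos_of_neg_of_neg hb ha⟩

lemma bary {p r s : Plane} (h : orient p r s ≠ 0) (a : Plane) :
    ∃ α β γ : ℝ, α + β + γ = 1 ∧ a 0 = α * p 0 + β * r 0 + γ * s 0 ∧
      a 1 = α * p 1 + β * r 1 + γ * s 1 ∧ α * orient p r s = orient r s a ∧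
      β * orient p r s = orient s p a ∧ γ * orient p r s = orient p r a := by
  refine ⟨orient r s a / orient p r s, orient s p a / orient p r s, orient p r a / orient p r s,
    ?_, ?_, ?_, div_mul_cancel₀ _ h, div_mul_cancel₀ _ h, div_mul_cancel₀ _ h⟩
  · field_simp; unfold orient; ring
  · field_simp; unfold orient; ring
  · field_simp; unfold orient; ring

/-- A segment that starts on the side $rs$, heads to the half-plane of $p$ and ends outside the
triangle must leave through one of the other two sides. -/
lemma exists_mem_side {p r s z a : Plane} (h : orient p r s ≠ 0) (hz : z ∈ segment ℝ r s)
    (ha : 0 ≤ orient r s a * orient p r s) (hna : a ∉ triangle p r s) :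
    ∃ u ∈ segment ℝ z a, u ∈ segment ℝ p r ∨ u ∈ segment ℝ p s := by
  obtain ⟨α, β, γ, hsum, ha0, ha1, hα, hβ, hγ⟩ := bary h a
  obtain ⟨t, ht0, ht1, hz0, hz1⟩ := mem_segment_coord.1 hz
  have hα0 : 0 ≤ α := by
    rw [← hα] at ha
    have h2 : 0 < orient p r s * orient p r s := mul_self_pos.2 h
    by_contra! hc
    nlinarith
  have hneg : β < 0 ∨ γ < 0 := by
    by_contra! hc
    exact hna (mem_triangle_coord.2 ⟨α, β, γ, hα0, hc.1, hc.2, hsum, ha0, ha1⟩)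
  obtain hα' : α = 1 - β - γ := by linarith
  -- From $z$ to $a$ the weight of $r$ falls from $1-t$ to $\beta$, hence vanishes at parameter
  -- $(1-t)/(1-t-\beta)$. The sign condition says that the weight of $s$ is still nonnegative there,
  -- so the exit is through $ps$. `key2` is the mirror case.
  have key1 : β < 0 → 0 ≤ -β * t + γ * (1 - t) →
      ∃ u ∈ segment ℝ z a, u ∈ segment ℝ p r ∨ u ∈ segment ℝ p s := by
    intro hb hX
    have hd : 0 < 1 - t - β := by linarith
    refine ⟨!₂[(-β * z 0 + (1 - t) * a 0) / (1 - t - β), (-β * z 1 + (1 - t) * a 1) / (1 - t - β)],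
      mem_segment_coord.2 ⟨(1 - t) / (1 - t - β), by apply div_nonneg <;> linarith, ?_, ?_, ?_⟩,
      Or.inr (mem_segment_coord.2 ⟨(-β * t + γ * (1 - t)) / (1 - t - β), by positivity, ?_, ?_, ?_⟩)⟩
    · rw [div_le_one hd]; linarith
    · simp; field_simp; ring
    · simp; field_simp; ring
    · rw [div_le_one hd]; nlinarith
    · simp [hz0, ha0, hα']; field_simp; ring
    · simp [hz1, ha1, hα']; field_simp; ring
  have key2 : γ < 0 → -β * t + γ * (1 - t) ≤ 0 →
      ∃ u ∈ segment ℝ z a, u ∈ segment ℝ p r ∨ u ∈ segment ℝ p s := by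
    intro hb hX
    have hd : 0 < t - γ := by linarith
    refine ⟨!₂[(-γ * z 0 + t * a 0) / (t - γ), (-γ * z 1 + t * a 1) / (t - γ)],
      mem_segment_coord.2 ⟨t / (t - γ), by positivity, ?_, ?_, ?_⟩,
      Or.inl (mem_segment_coord.2 ⟨(-γ * (1 - t) + β * t) / (t - γ),
        div_nonneg (by linarith) hd.le, ?_, ?_, ?_⟩)⟩
    · rw [div_le_one hd]; linarith
    · simp; field_simp; ring
    · simp; field_simp; ring
    · rw [div_le_one hd]; nlinarith
    · simp [hz0, ha0, hα']; field_simp; ring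
    · simp [hz1, ha1, hα']; field_simp; ring
  rcases lt_or_ge β 0 with hb | hb
  · rcases le_total 0 (-β * t + γ * (1 - t)) with hX | hX
    · exact key1 hb hX
    · rcases lt_or_ge γ 0 with hc | hc
      · exact key2 hc hX
      · exact key1 hb (by nlinarith)
  · have hc : γ < 0 := hneg.resolve_left (not_lt.2 hb)
    exact key2 hc (by nlinarith)

/-! ### Metric facts -/

lemma dist_sq_coord (a b : Plane) : dist a b ^ 2 = (a 0 - b 0) ^ 2 + (a 1 - b 1) ^ 2 := by
  rw [EuclideanSpace.dist_eq, Real.sq_sqrt (by positivity)]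
  simp [Fin.sum_univ_two, Real.dist_eq, sq_abs]

lemma dist_le_iff_coord (a b c d : Plane) : dist a b ≤ dist c d ↔
    (a 0 - b 0) ^ 2 + (a 1 - b 1) ^ 2 ≤ (c 0 - d 0) ^ 2 + (c 1 - d 1) ^ 2 := by
  rw [← dist_sq_coord, ← dist_sq_coord]
  exact (sq_le_sq₀ dist_nonneg dist_nonneg).symm

/-- A point that is outside the lunes of `c a` and `c b` and lies in the triangle `c a b` is a
vertex. -/
lemma eq_vertex_of_mem_triangle {c a b x : Plane} (hx : x ∈ triangle c a b)
    (ha : dist c a ≤ dist x c ∨ dist c a ≤ dist x a)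
    (hb : dist c b ≤ dist x c ∨ dist c b ≤ dist x b) : x = c ∨ x = a ∨ x = b := by
  obtain ⟨α, β, γ, h1, h2, h3, hs, hx0, hx1⟩ := mem_triangle_coord.1 hx
  simp only [dist_le_iff_coord] at ha hb
  obtain ⟨a0, ha0⟩ : ∃ t, t = a 0 - c 0 := ⟨_, rfl⟩
  obtain ⟨a1, ha1⟩ : ∃ t, t = a 1 - c 1 := ⟨_, rfl⟩
  obtain ⟨b0, hb0⟩ : ∃ t, t = b 0 - c 0 := ⟨_, rfl⟩
  obtain ⟨b1, hb1⟩ : ∃ t, t = b 1 - c 1 := ⟨_, rfl⟩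
  obtain ⟨x0, hx0'⟩ : ∃ t, t = x 0 - c 0 := ⟨_, rfl⟩
  obtain ⟨x1, hx1'⟩ : ∃ t, t = x 1 - c 1 := ⟨_, rfl⟩
  have e0 : x0 = β * a0 + γ * b0 := by
    rw [hx0', hx0, ha0, hb0]; obtain rfl : α = 1 - β - γ := by linarith
    ring
  have e1 : x1 = β * a1 + γ * b1 := by
    rw [hx1', hx1, ha1, hb1]; obtain rfl : α = 1 - β - γ := by linarith
    ring
  -- With $c$ as origin, $|x|^2=\beta\,x\cdot a+\gamma\,x\cdot b$. Being outside both lunes and not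
  -- a vertex forces $x\cdot a,\ x\cdot b<|x|^2$, which contradicts $\beta+\gamma\le 1$.
  have hq : x0 ^ 2 + x1 ^ 2 = β * (x0 * a0 + x1 * a1) + γ * (x0 * b0 + x1 * b1) := by
    linear_combination x0 * e0 + x1 * e1
  have ha' : a0 ^ 2 + a1 ^ 2 ≤ x0 ^ 2 + x1 ^ 2 ∨ 2 * (x0 * a0 + x1 * a1) ≤ x0 ^ 2 + x1 ^ 2 := by
    refine ha.imp ?_ ?_ <;> intro h <;> rw [hx0', hx1', ha0, ha1]
    all_goals linarith
  have hb' : b0 ^ 2 + b1 ^ 2 ≤ x0 ^ 2 + x1 ^ 2 ∨ 2 * (x0 * b0 + x1 * b1) ≤ x0 ^ 2 + x1 ^ 2 := by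
    refine hb.imp ?_ ?_ <;> intro h <;> rw [hx0', hx1', hb0, hb1]
    all_goals linarith
  have hzero : ∀ u v : ℝ, u ^ 2 + v ^ 2 ≤ 0 → u = 0 ∧ v = 0 := by
    intro u v h
    exact ⟨by nlinarith [sq_nonneg u, sq_nonneg v], by nlinarith [sq_nonneg u, sq_nonneg v]⟩
  by_contra! hcon
  obtain ⟨hc, hca, hcb⟩ := hcon
  have hX : 0 < x0 ^ 2 + x1 ^ 2 := by
    by_contra! h
    obtain ⟨g0, g1⟩ := hzero _ _ h
    exact hc (plane_ext (by linarith) (by linarith))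
  have hA : 0 < (x0 - a0) ^ 2 + (x1 - a1) ^ 2 := by
    by_contra! h
    obtain ⟨g0, g1⟩ := hzero _ _ h
    exact hca (plane_ext (by linarith) (by linarith))
  have hB : 0 < (x0 - b0) ^ 2 + (x1 - b1) ^ 2 := by
    by_contra! h
    obtain ⟨g0, g1⟩ := hzero _ _ h
    exact hcb (plane_ext (by linarith) (by linarith))
  have hta : x0 * a0 + x1 * a1 < x0 ^ 2 + x1 ^ 2 := by
    rcases ha' with h | h <;> linarith
  have htb : x0 * b0 + x1 * b1 < x0 ^ 2 + x1 ^ 2 := by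
    rcases hb' with h | h <;> linarith
  have hle : 0 ≤ (1 - β - γ) * (x0 ^ 2 + x1 ^ 2) := mul_nonneg (by linarith) hX.le
  have hβ := mul_le_mul_of_nonneg_left hta.le h2
  have hγ := mul_le_mul_of_nonneg_left htb.le h3
  rcases h2.eq_or_lt with h0 | hpos
  · rcases h3.eq_or_lt with h0' | hpos'
    · rw [← h0, ← h0'] at hq; linarith
    · have := mul_lt_mul_of_pos_left htb hpos'
      linarith
  · have := mul_lt_mul_of_pos_left hta hpos
    linarith

/-- Crossing segments: some endpoint of one lies in the lune of the other. -/
lemma lune_of_crossing {a b c d z : Plane} (hz : z ∈ segment ℝ a b) (hz' : z ∈ segment ℝ c d)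
    (hac : a ≠ c) (had : a ≠ d) (hbc : b ≠ c) (hbd : b ≠ d) :
    (dist c a < dist a b ∧ dist c b < dist a b) ∨ (dist d a < dist a b ∧ dist d b < dist a b) ∨
    (dist a c < dist c d ∧ dist a d < dist c d) ∨ (dist b c < dist c d ∧ dist b d < dist c d) := by
  obtain ⟨s, hs0, hs1, hx, hy⟩ := mem_segment_coord.1 hz
  obtain ⟨t, ht0, ht1, hx', hy'⟩ := mem_segment_coord.1 hz'
  -- If the angle at $c$ is right or obtuse, then $ab$ is strictly the longest side, so $c$ is in
  -- the lune of $ab$. Otherwise all four angles of the quadrilateral would be acute.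
  have key : ∀ a b c : Plane, a ≠ c → b ≠ c →
      (a 0 - c 0) * (b 0 - c 0) + (a 1 - c 1) * (b 1 - c 1) ≤ 0 →
      dist c a < dist a b ∧ dist c b < dist a b := by
    intro a b c hac hbc h
    have pos : ∀ a c : Plane, a ≠ c → 0 < (a 0 - c 0) ^ 2 + (a 1 - c 1) ^ 2 := by
      intro a c h
      rw [← dist_sq_coord]
      have := dist_pos.2 h
      positivity
    have h1 := pos a c hac
    have h2 := pos b c hbc
    rw [← not_le, ← not_le, dist_le_iff_coord, dist_le_iff_coord]
    constructor <;> intro h' <;> nlinarith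
  by_contra! hcon
  obtain ⟨n1, n2, n3, n4⟩ := hcon
  have p1 : 0 < (a 0 - c 0) * (b 0 - c 0) + (a 1 - c 1) * (b 1 - c 1) := by
    by_contra! h
    obtain ⟨g1, g2⟩ := key a b c hac hbc h
    exact absurd (n1 g1) (not_le.2 g2)
  have p2 : 0 < (a 0 - d 0) * (b 0 - d 0) + (a 1 - d 1) * (b 1 - d 1) := by
    by_contra! h
    obtain ⟨g1, g2⟩ := key a b d had hbd h
    exact absurd (n2 g1) (not_le.2 g2)
  have p3 : 0 < (c 0 - a 0) * (d 0 - a 0) + (c 1 - a 1) * (d 1 - a 1) := by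
    by_contra! h
    obtain ⟨g1, g2⟩ := key c d a hac.symm had.symm h
    exact absurd (n3 g1) (not_le.2 g2)
  have p4 : 0 < (c 0 - b 0) * (d 0 - b 0) + (c 1 - b 1) * (d 1 - b 1) := by
    by_contra! h
    obtain ⟨g1, g2⟩ := key c d b hbc.symm hbd.symm h
    exact absurd (n4 g1) (not_le.2 g2)
  -- A power-of-a-point identity whose right side changes sign when the segments are exchanged; both
  -- versions would be positive if all four angles were acute.
  have pow : ∀ (a b c d z : Plane) (s t : ℝ), z 0 = (1 - s) * a 0 + s * b 0 →
      z 1 = (1 - s) * a 1 + s * b 1 → z 0 = (1 - t) * c 0 + t * d 0 →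
      z 1 = (1 - t) * c 1 + t * d 1 →
      (1 - t) * ((a 0 - c 0) * (b 0 - c 0) + (a 1 - c 1) * (b 1 - c 1)) +
      t * ((a 0 - d 0) * (b 0 - d 0) + (a 1 - d 1) * (b 1 - d 1)) =
      t * (1 - t) * ((c 0 - d 0) ^ 2 + (c 1 - d 1) ^ 2) -
      s * (1 - s) * ((a 0 - b 0) ^ 2 + (a 1 - b 1) ^ 2) := by
    intro a b c d z s t h0 h1 h0' h1'
    have e0 : (a 0 - z 0) * (b 0 - z 0) = - (s * (1 - s) * (a 0 - b 0) ^ 2) := by rw [h0]; ring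
    have e1 : (a 1 - z 1) * (b 1 - z 1) = - (s * (1 - s) * (a 1 - b 1) ^ 2) := by rw [h1]; ring
    rw [h0'] at e0
    rw [h1'] at e1
    linear_combination e0 + e1
  have q1 := pow a b c d z s t hx hy hx' hy'
  have q2 := pow c d a b z t s hx' hy' hx hy
  have r1 : 0 < (1 - t) * ((a 0 - c 0) * (b 0 - c 0) + (a 1 - c 1) * (b 1 - c 1)) +
      t * ((a 0 - d 0) * (b 0 - d 0) + (a 1 - d 1) * (b 1 - d 1)) := by
    rcases ht0.eq_or_lt with h | h
    · rw [← h]; linarith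
    · have := mul_pos h p2
      have := mul_nonneg (by linarith : 0 ≤ 1 - t) p1.le
      linarith
  have r2 : 0 < (1 - s) * ((c 0 - a 0) * (d 0 - a 0) + (c 1 - a 1) * (d 1 - a 1)) +
      s * ((c 0 - b 0) * (d 0 - b 0) + (c 1 - b 1) * (d 1 - b 1)) := by
    rcases hs0.eq_or_lt with h | h
    · rw [← h]; linarith
    · have := mul_pos h p4
      have := mul_nonneg (by linarith : 0 ≤ 1 - s) p3.le
      linarith
  linarith

lemma dist_le_max_of_mem_triangle {r p q y : Plane} {K : ℝ} (hy : y ∈ triangle r p q)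
    (hp : dist r p ≤ K) (hq : dist r q ≤ K) : dist r y ≤ K := by
  obtain ⟨α, β, γ, h1, h2, h3, hs, rfl⟩ := hy
  have hc : Convex ℝ (Metric.closedBall r K) := convex_closedBall r K
  have hK : 0 ≤ K := dist_nonneg.trans hp
  rw [dist_comm, ← Metric.mem_closedBall]
  have := hc.sum_mem (t := Finset.univ) (w := ![α, β, γ]) (z := ![r, p, q])
    (by intro i _; fin_cases i <;> simpa)
    (by simp [Fin.sum_univ_three, hs])
    (by
      intro i _
      fin_cases i
      · simpa using hK
      · simpa [dist_comm] using hp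
      · simpa [dist_comm] using hq)
  simpa [Fin.sum_univ_three] using this

/-! ### Signed areas on segments and triangles, and visibility -/

lemma orient_of_mem_segment {a b z : Plane} (hz : z ∈ segment ℝ a b) :
    ∃ t : ℝ, 0 ≤ t ∧ t ≤ 1 ∧ ∀ u v : Plane,
      orient u v z = (1 - t) * orient u v a + t * orient u v b := by
  obtain ⟨t, h0, h1, hx, hy⟩ := mem_segment_coord.1 hz
  refine ⟨t, h0, h1, fun u v => ?_⟩
  unfold orient
  rw [hx, hy]; ring

lemma orient_of_mem_triangle {p q r z : Plane} (hz : z ∈ triangle p q r) :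
    ∃ α β γ : ℝ, 0 ≤ α ∧ 0 ≤ β ∧ 0 ≤ γ ∧ α + β + γ = 1 ∧ ∀ u v : Plane,
      orient u v z = α * orient u v p + β * orient u v q + γ * orient u v r := by
  obtain ⟨α, β, γ, h1, h2, h3, hs, hx, hy⟩ := mem_triangle_coord.1 hz
  refine ⟨α, β, γ, h1, h2, h3, hs, fun u v => ?_⟩
  unfold orient
  rw [hx, hy]
  obtain rfl : α = 1 - β - γ := by linarith
  ring

@[simp] lemma orient_self_right (p q : Plane) : orient p q q = 0 := by unfold orient; ring
@[simp] lemma orient_self_outer (p q : Plane) : orient p q p = 0 := by unfold orient; ring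

lemma triangle_swap_left {p q r : Plane} : triangle p q r = triangle q p r := by
  ext x
  constructor <;> rintro ⟨α, β, γ, h1, h2, h3, hs, rfl⟩ <;>
    exact ⟨β, α, γ, h2, h1, h3, by linarith, by abel⟩

lemma right_mem_triangle (p q r : Plane) : r ∈ triangle p q r :=
  ⟨0, 0, 1, by simp, by simp, by simp, by simp, by simp⟩

lemma inWedge_of_mem_triangle {v a b y : Plane} (hy : y ∈ triangle v a b)
    (hD : orient v a b ≠ 0) (h1 : orient v y b ≠ 0) (h2 : orient v a y ≠ 0) :
    InWedge v a b y := by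
  obtain ⟨α, β, γ, -, hβ, hγ, -, ho⟩ := orient_of_mem_triangle hy
  have e2 := ho v a
  have e1 : orient v y b = β * orient v a b := by
    rw [← orient_rotate v y b, ← orient_rotate y b v, ho b v, orient_self_right, orient_self_outer,
      orient_rotate a b v, orient_rotate v a b]
    ring
  simp only [orient_self_outer, orient_self_right, mul_zero, zero_add] at e2
  have hpos : 0 < orient v a b * orient v a b := mul_self_pos.2 hD
  have hβ' : 0 < β := hβ.lt_of_ne (by rintro rfl; exact h1 (by rw [e1, zero_mul]))
  have hγ' : 0 < γ := hγ.lt_of_ne (by rintro rfl; exact h2 (by rw [e2, zero_mul]))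
  exact ⟨by rw [e1, mul_assoc]; positivity, by rw [e2, mul_assoc]; positivity⟩

lemma inWedge_of_meet {v d a b : Plane} (hD : orient v a b ≠ 0) (h1 : orient v d b ≠ 0)
    (h2 : orient v a d ≠ 0) (h : ¬ Disjoint (segment ℝ v d) (segment ℝ a b)) :
    InWedge v a b d := by
  obtain ⟨z, hz, hz'⟩ := Set.not_disjoint_iff.1 h
  obtain ⟨t, t0, t1, ht⟩ := orient_of_mem_segment hz
  obtain ⟨s, s0, s1, hs⟩ := orient_of_mem_segment hz'
  have e1 : t * orient v d b = (1 - s) * orient v a b := by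
    have := (ht b v).symm.trans (hs b v)
    simp only [orient_self_outer, orient_self_right] at this
    rw [← orient_rotate b v d, ← orient_rotate b v a] at this
    linarith
  have e2 : t * orient v a d = s * orient v a b := by
    have := (ht v a).symm.trans (hs v a)
    simpa using this
  have hpos : 0 < orient v a b * orient v a b := mul_self_pos.2 hD
  have ht0 : 0 < t := by
    refine t0.lt_of_ne ?_
    rintro rfl
    apply hD
    linarith
  have hs1 : 0 < 1 - s := by
    refine (sub_nonneg.2 s1).lt_of_ne ?_
    intro h
    rw [← h, zero_mul] at e1
    exact (mul_ne_zero ht0.ne' h1) e1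
  have hs0 : 0 < s := by
    refine s0.lt_of_ne ?_
    intro h
    rw [← h, zero_mul] at e2
    exact (mul_ne_zero ht0.ne' h2) e2
  constructor
  · refine pos_of_mul_pos_right (a := t) ?_ ht0.le
    rw [← mul_assoc, e1, mul_assoc]; positivity
  · refine pos_of_mul_pos_right (a := t) ?_ ht0.le
    rw [← mul_assoc, e2, mul_assoc]; positivity

/-- Of the two ends of the crossing segment, one lies on the side of $ab$ that contains $v$; apply
`exists_mem_side` from the crossing point towards that end. -/
lemma meets_side {v a b c d : Plane} (hD : orient v a b ≠ 0) (hc : orient a b c ≠ 0)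
    (hc' : c ∉ triangle v a b) (hd' : d ∉ triangle v a b)
    (h : ¬ Disjoint (segment ℝ c d) (segment ℝ a b)) :
    ¬ Disjoint (segment ℝ c d) (segment ℝ v a) ∨ ¬ Disjoint (segment ℝ c d) (segment ℝ v b) := by
  obtain ⟨z, hz, hz'⟩ := Set.not_disjoint_iff.1 h
  obtain ⟨t, t0, t1, ht⟩ := orient_of_mem_segment hz
  obtain ⟨s, s0, s1, hs⟩ := orient_of_mem_segment hz'
  have e := (ht a b).symm.trans (hs a b)
  simp only [orient_self_outer, orient_self_right, mul_zero, add_zero] at e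
  have key : ∀ x, x ∈ segment ℝ c d → x ∉ triangle v a b →
      0 ≤ orient a b x * orient v a b →
      ¬ Disjoint (segment ℝ c d) (segment ℝ v a) ∨
        ¬ Disjoint (segment ℝ c d) (segment ℝ v b) := by
    intro x hx hxt hxo
    obtain ⟨u, hu, hu'⟩ := exists_mem_side hD hz' hxo hxt
    have hu2 : u ∈ segment ℝ c d := (convex_segment c d).segment_subset hz hx hu
    exact hu'.imp (fun h => Set.not_disjoint_iff.2 ⟨u, hu2, h⟩)
      (fun h => Set.not_disjoint_iff.2 ⟨u, hu2, h⟩)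
  rcases le_total 0 (orient a b c * orient v a b) with h0 | h0
  · exact key c (left_mem_segment ℝ c d) hc' h0
  · refine key d (right_mem_segment ℝ c d) hd' ?_
    have hlt : orient a b c * orient v a b < 0 := h0.lt_of_ne (mul_ne_zero hc hD)
    have e' : (1 - t) * (orient a b c * orient v a b) + t * (orient a b d * orient v a b) = 0 := by
      linear_combination orient v a b * e
    by_contra! hneg
    rcases t0.eq_or_lt with ht0 | ht0
    · rw [← ht0] at e'; linarith
    · have := mul_neg_of_pos_of_neg ht0 hneg
      have := mul_nonpos_of_nonneg_of_nonpos (sub_nonneg.2 t1) h0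
      linarith

variable {S : Finset Plane}

lemma GeneralPosition.orient_ne (hgen : GeneralPosition S) {a b c : S} (hab : a ≠ b)
    (hac : a ≠ c) (hbc : b ≠ c) : orient (a : Plane) b c ≠ 0 := fun h =>
  hgen a a.2 b b.2 c c.2 (fun h => hab (Subtype.ext h))
    (fun h => hac (Subtype.ext h)) (fun h => hbc (Subtype.ext h))
    (collinear_of_orient_eq_zero h)

/-- Among the points with property `P` there is one that is angularly closest to the ray `v p`. -/
lemma exists_no_inWedge (v p : Plane) (P : S → Prop) (h : ∃ x, P x) :
    ∃ y, P y ∧ ∀ a, P a → ¬ InWedge v p y a := by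
  let rel : S → S → Prop := fun a y => InWedge v p y a
  have : IsTrans S rel := ⟨fun a b c hab hbc => InWedge.trans hbc hab⟩
  have : Std.Irrefl rel := ⟨fun a h => not_inWedge_self_right _ _ _ h⟩
  obtain ⟨y, hy, hmin⟩ :=
    (Finite.wellFounded_of_trans_of_irrefl rel).has_min {x | P x} h
  exact ⟨y, hy, fun a ha => hmin a ha⟩

/-- If the sides `r p` and `p q` of a triangle are crossed by no edge of `G`, then `r` sees some
point of the triangle. -/
lemma exists_visible (hgen : GeneralPosition S) (G : SimpleGraph S) {r p q : S}
    (hrp : r ≠ p) (hrq : r ≠ q) (hpq : p ≠ q)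
    (H1 : ∀ a b, G.Adj a b → a ≠ r → b ≠ r → a ≠ p → b ≠ p →
      Disjoint (segment ℝ (a : Plane) b) (segment ℝ (r : Plane) p))
    (H2 : ∀ a b, G.Adj a b → a ≠ r → b ≠ r → a ≠ p → b ≠ p → a ≠ q → b ≠ q →
      Disjoint (segment ℝ (a : Plane) b) (segment ℝ (p : Plane) q))
    (H3 : ∀ b, G.Adj p b → b ≠ r → b = q ∨ ¬ InWedge (p : Plane) r q b) :
    ∃ y : S, y ≠ r ∧ y ≠ p ∧ (y : Plane) ∈ triangle (r : Plane) p q ∧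
      ∀ a b, G.Adj a b → a ≠ r → b ≠ r → a ≠ y → b ≠ y →
        Disjoint (segment ℝ (a : Plane) b) (segment ℝ (r : Plane) y) := by
  -- Take the point of the triangle angularly closest to the ray $rp$, so that the part of the
  -- triangle between $rp$ and $ry$ is empty. An edge crossing $ry$ would have to leave this part
  -- through $rp$ or $pq$.
  obtain ⟨y, ⟨hyr, hyp, hyt⟩, hmin⟩ := exists_no_inWedge (r : Plane) p
    (fun y : S => y ≠ r ∧ y ≠ p ∧ (y : Plane) ∈ triangle (r : Plane) p q)
    ⟨q, hrq.symm, hpq.symm, right_mem_triangle _ _ _⟩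
  refine ⟨y, hyr, hyp, hyt, ?_⟩
  have hD : orient (r : Plane) p q ≠ 0 := hgen.orient_ne hrp hrq hpq
  -- edges at `p`
  have hedge_p : ∀ b, G.Adj p b → b ≠ r → b ≠ y →
      Disjoint (segment ℝ (p : Plane) b) (segment ℝ (r : Plane) y) := by
    intro b hb hbr hby
    by_contra hdis
    have hpb : p ≠ b := hb.ne
    have hw : InWedge (p : Plane) r y b :=
      inWedge_of_meet (hgen.orient_ne hrp.symm hyp.symm hyr.symm)
        (hgen.orient_ne hpb hyp.symm hby) (hgen.orient_ne hrp.symm hpb hbr.symm) hdis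
    by_cases hyq : y = q
    · subst hyq
      exact (H3 b hb hbr).elim (fun h => hby h) (fun h => h hw)
    · have hw' : InWedge (p : Plane) r q y := inWedge_of_mem_triangle
        (by rwa [triangle_swap_left]) (hgen.orient_ne hrp.symm hpq hrq)
        (hgen.orient_ne hyp.symm hpq hyq) (hgen.orient_ne hrp.symm hyp.symm hyr.symm)
      rcases H3 b hb hbr with rfl | h
      · exact not_inWedge_self_right _ _ _ (hw'.trans hw)
      · exact h (hw'.trans hw)
  -- the end of a crossing edge that lies on the same side as `p` leads to a contradiction
  obtain ⟨α, β, γ, hα, hβ, hγ, hsum, hy0, hy1⟩ := mem_triangle_coord.1 hyt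
  have horient : ∀ u v : Plane, orient u v y =
      α * orient u v r + β * orient u v p + γ * orient u v q := by
    intro u v
    unfold orient
    rw [hy0, hy1]
    obtain rfl : α = 1 - β - γ := by linarith
    ring
  have hrpy : orient (r : Plane) p y = γ * orient (r : Plane) p q := by
    rw [horient]; simp
  have hqry : orient (q : Plane) r y = β * orient (r : Plane) p q := by
    rw [horient, orient_rotate p q r, orient_rotate r p q]; simp
  have hpqy : orient (p : Plane) q y = α * orient (r : Plane) p q := by
    rw [horient, orient_rotate r p q]; simp
  have hDD : 0 < orient (r : Plane) p q * orient (r : Plane) p q := mul_self_pos.2 hD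
  have hγ' : 0 < γ := hγ.lt_of_ne (by
    rintro rfl
    exact hgen.orient_ne hrp hyr.symm hyp.symm (by rw [hrpy, zero_mul]))
  have hδ : 0 < β + γ := by linarith
  -- the point where the ray `r y` leaves the triangle
  obtain ⟨y', hy'0, hy'1⟩ : ∃ y' : Plane, y' 0 = (β * (p : Plane) 0 + γ * (q : Plane) 0) / (β + γ) ∧
      y' 1 = (β * (p : Plane) 1 + γ * (q : Plane) 1) / (β + γ) :=
    ⟨!₂[(β * (p : Plane) 0 + γ * (q : Plane) 0) / (β + γ),
      (β * (p : Plane) 1 + γ * (q : Plane) 1) / (β + γ)], by simp, by simp⟩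
  obtain rfl : α = 1 - β - γ := by linarith
  have hray : ∀ w : Plane, orient (r : Plane) w y = (β + γ) * orient (r : Plane) w y' := by
    intro w
    unfold orient
    rw [hy0, hy1, hy'0, hy'1]; field_simp; ring
  have hyseg : (y : Plane) ∈ segment ℝ (r : Plane) y' := by
    refine mem_segment_coord.2 ⟨β + γ, hδ.le, by linarith, ?_, ?_⟩
    · rw [hy0, hy'0]; field_simp; ring
    · rw [hy1, hy'1]; field_simp; ring
  have hy'seg : y' ∈ segment ℝ (p : Plane) q := by
    refine mem_segment_coord.2 ⟨γ / (β + γ), by positivity, ?_, ?_, ?_⟩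
    · rw [div_le_one hδ]; linarith
    · rw [hy'0]; field_simp; ring
    · rw [hy'1]; field_simp; ring
  have hrpy' : orient (r : Plane) p y' ≠ 0 := by
    intro h
    have := hray p
    rw [h, mul_zero, hrpy] at this
    exact mul_ne_zero hγ'.ne' hD this
  have hsub : triangle (p : Plane) r y' ⊆ triangle (r : Plane) p q := by
    intro x hx
    obtain ⟨a, b, c, ha, hb, hc, hs, hx0, hx1⟩ := mem_triangle_coord.1 hx
    refine mem_triangle_coord.2 ⟨b, a + c * (β / (β + γ)), c * (γ / (β + γ)), hb, by positivity,
      by positivity, ?_, ?_, ?_⟩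
    · field_simp; linear_combination (β + γ) * hs
    · rw [hx0, hy'0]; field_simp; ring
    · rw [hx1, hy'1]; field_simp; ring
  have main : ∀ a b, G.Adj a b → a ≠ r → b ≠ r → a ≠ y → b ≠ y → a ≠ p → b ≠ p →
      ¬ Disjoint (segment ℝ (a : Plane) b) (segment ℝ (r : Plane) y) →
      0 ≤ orient (r : Plane) y a * orient (r : Plane) y p → False := by
    intro a b hab har hbr hay hby hap hbp hdis hside
    obtain ⟨z, hz, hz'⟩ := Set.not_disjoint_iff.1 hdis
    have hat : (a : Plane) ∉ triangle (p : Plane) r y' := by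
      intro hat
      refine hmin a ⟨har, hap, hsub hat⟩ ?_
      have hray' := hray a
      have hne : orient (r : Plane) a y ≠ 0 := hgen.orient_ne har.symm hyr.symm hay
      have hw : InWedge (r : Plane) p y' a := by
        refine inWedge_of_mem_triangle (by rwa [triangle_swap_left]) hrpy' ?_
          (hgen.orient_ne hrp har.symm hap.symm)
        intro h0
        rw [h0, mul_zero] at hray'
        exact hne hray'
      obtain ⟨w1, w2⟩ := hw
      refine ⟨?_, ?_⟩
      · rw [hray', hray p]
        have : 0 < (β + γ) * (β + γ) * (orient (r : Plane) a y' * orient (r : Plane) p y') := by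
          positivity
        linarith
      · rw [hray p]
        have : 0 < (β + γ) * (orient (r : Plane) p a * orient (r : Plane) p y') := by positivity
        linarith
    have hside' : 0 ≤ orient (r : Plane) y' a * orient (p : Plane) r y' := by
      have e1 := hray a
      have e2 := hray p
      rw [orient_swap (r : Plane) a y, orient_swap (r : Plane) p y] at hside
      rw [e1, e2] at hside
      rw [orient_swap (r : Plane) a y', ← orient_rotate (p : Plane) r y',
        orient_swap (r : Plane) p y']
      by_contra! hneg
      have : 0 < (β + γ) * (β + γ) * (-(-orient (r : Plane) a y' * -orient (r : Plane) p y')) :=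
        mul_pos (by positivity) (by linarith)
      linarith
    obtain ⟨u, hu, hu'⟩ := exists_mem_side (by
      rw [← orient_rotate (p : Plane) r y', orient_swap (r : Plane) p y']
      simpa using hrpy') ((convex_segment _ _).segment_subset (left_mem_segment ℝ _ _) hyseg hz')
      hside' hat
    have hu2 : u ∈ segment ℝ (a : Plane) b :=
      (convex_segment _ _).segment_subset hz (left_mem_segment ℝ _ _) hu
    rcases hu' with hu' | hu'
    · rw [segment_symm] at hu'
      exact Set.not_disjoint_iff.2 ⟨u, hu2, hu'⟩ (H1 a b hab har hbr hap hbp)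
    · have hu3 : u ∈ segment ℝ (p : Plane) q :=
        (convex_segment _ _).segment_subset (left_mem_segment ℝ _ _) hy'seg hu'
      -- The line $ry$ separates $q$ from $p$, whereas $a$ is on the side of $p$.
      have haq : a ≠ q := by
        rintro rfl
        have hqy := hgen.orient_ne (a := a) (b := r) (c := y) har hay hyr.symm
        have hβ' : 0 < β := hβ.lt_of_ne (by rintro rfl; exact hqy (by rw [hqry, zero_mul]))
        rw [orient_rotate (a : Plane) r y, hqry, orient_swap (r : Plane) p y, hrpy] at hside
        have := mul_pos (mul_pos hβ' hγ') hDD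
        linarith
      -- An edge ending at $q$ is not covered by `H2`, but apart from $q$ it stays strictly on one
      -- side of the line $pq$, so it cannot pass through $u$.
      by_cases hbq : b = q
      · subst hbq
        obtain ⟨t, t0, t1, ht⟩ := orient_of_mem_segment hz
        obtain ⟨l, l0, l1, hl⟩ := orient_of_mem_segment hz'
        obtain ⟨s, s0, s1, hs⟩ := orient_of_mem_segment hu
        obtain ⟨m, m0, m1, hm⟩ := orient_of_mem_segment hu3
        have e1 := ht p b
        have e2 := hl p b
        have e3 := hs p b
        have e4 := hm p b
        rw [hpqy, orient_rotate r p b] at e2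
        simp only [orient_self_outer, orient_self_right, mul_zero, add_zero] at e1 e4
        have hα' : 0 < 1 - β - γ := hα.lt_of_ne (by
          intro h0
          refine hgen.orient_ne (a := p) (b := b) (c := y) hpq hyp.symm hby ?_
          rw [hpqy, ← h0, zero_mul])
        have hc : 0 < (1 - l) + l * (1 - β - γ) := by
          rcases l0.eq_or_lt with h | h
          · rw [← h]; norm_num
          · have := mul_pos h hα'
            linarith
        have hzD : orient (p : Plane) b z * orient (r : Plane) p b =
            ((1 - l) + l * (1 - β - γ)) * (orient (r : Plane) p b * orient (r : Plane) p b) := by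
          rw [e2]; ring
        have hzpos : 0 < orient (p : Plane) b z * orient (r : Plane) p b := by
          rw [hzD]; positivity
        have hapos : 0 < orient (p : Plane) b a * orient (r : Plane) p b := by
          rw [e1, mul_assoc] at hzpos
          exact pos_of_mul_pos_right hzpos (by linarith)
        have : 0 < orient (p : Plane) b u * orient (r : Plane) p b := by
          rw [e3]
          rcases s0.eq_or_lt with h | h
          · rw [← h]; simpa using hzpos
          · have h1 := mul_pos h hapos
            have h2 := mul_nonneg (sub_nonneg.2 s1) hzpos.le
            linarith
        rw [e4, zero_mul] at this
        exact this.false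
      · exact Set.not_disjoint_iff.2 ⟨u, hu2, hu3⟩ (H2 a b hab har hbr hap hbp haq hbq)
  intro a b hab har hbr hay hby
  by_cases hap : a = p
  · subst hap; exact hedge_p b hab hbr hby
  by_cases hbp : b = p
  · subst hbp; rw [segment_symm]; exact hedge_p a hab.symm har hay
  by_contra hdis
  rcases le_total 0 (orient (r : Plane) y a * orient (r : Plane) y p) with h | h
  · exact main a b hab har hbr hay hby hap hbp hdis h
  · refine main b a hab.symm hbr har hby hay hbp hap (by rwa [segment_symm]) ?_
    obtain ⟨z, hz, hz'⟩ := Set.not_disjoint_iff.1 hdis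
    obtain ⟨t, t0, t1, ht⟩ := orient_of_mem_segment hz
    obtain ⟨s, s0, s1, hs⟩ := orient_of_mem_segment hz'
    have e := (ht r y).symm.trans (hs r y)
    simp only [orient_self_outer, orient_self_right, mul_zero, add_zero] at e
    have e' : (1 - t) * (orient (r : Plane) y a * orient (r : Plane) y p) +
        t * (orient (r : Plane) y b * orient (r : Plane) y p) = 0 := by
      linear_combination orient (r : Plane) y p * e
    have hlt : orient (r : Plane) y a * orient (r : Plane) y p < 0 :=
      h.lt_of_ne (mul_ne_zero (hgen.orient_ne hyr.symm har.symm hay.symm)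
        (hgen.orient_ne hyr.symm hrp hyp))
    by_contra! hneg
    rcases t0.eq_or_lt with ht0 | ht0
    · rw [← ht0] at e'; linarith
    · have := mul_neg_of_pos_of_neg ht0 hneg
      have := mul_nonpos_of_nonneg_of_nonpos (sub_nonneg.2 t1) h
      linarith

/-! ### Minimum spanning trees -/

lemma forall_of_connected {V : Type*} {G : SimpleGraph V} (hG : G.Connected) {P : V → Prop}
    {a : V} (ha : P a) (h : ∀ u v, P u → G.Adj u v → P v) (v : V) : P v := by
  obtain ⟨p⟩ := hG.preconnected a v
  induction p with
  | nil => exact ha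
  | cons hadj _ ih => exact ih (h _ _ ha hadj)

lemma edgeLength_mk (a b : S) : edgeLength s(a, b) = dist (a : Plane) b := rfl

lemma edgeLength_nonneg (e : Sym2 S) : 0 ≤ edgeLength e := by
  induction e with
  | _ a b => rw [edgeLength_mk]; exact dist_nonneg

/-- No point lies in the open lune of an edge. -/
def LuneFree (M : SimpleGraph S) : Prop :=
  ∀ a b x : S, M.Adj a b → dist (a : Plane) b ≤ dist (x : Plane) a ∨
    dist (a : Plane) b ≤ dist (x : Plane) b

/-- Exchange argument: after deleting $ab$, an edge from $x$ on the side of $a$ to $b$ reconnects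
the tree, so it cannot be shorter than $ab$. -/
lemma IsMST.dist_le_of_reachable {M : SimpleGraph S} (hM : IsMST M) {a b x : S} (hab : M.Adj a b)
    (hside : ∀ v, (M.deleteEdges {s(a, b)}).Reachable v a ∨ (M.deleteEdges {s(a, b)}).Reachable v b)
    (hx : (M.deleteEdges {s(a, b)}).Reachable x a) :
    dist (a : Plane) b ≤ dist (x : Plane) b := by
  classical
  by_cases hxb : x = b
  · subst hxb
    exfalso
    exact (SimpleGraph.isBridge_iff.1
      (SimpleGraph.isAcyclic_iff_forall_adj_isBridge.1 hM.1.isAcyclic hab)) hx.symm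
  set T : SimpleGraph S := M.deleteEdges {s(a, b)} ⊔ SimpleGraph.edge x b with hT
  have hxbT : T.Adj x b := Or.inr ((SimpleGraph.edge_adj _ _ _ _).2 ⟨Or.inl ⟨rfl, rfl⟩, hxb⟩)
  have hle : M.deleteEdges {s(a, b)} ≤ T := le_sup_left
  have hreach : ∀ v, T.Reachable v b := by
    intro v
    rcases hside v with h | h
    · exact ((h.mono hle).trans (hx.mono hle).symm).trans hxbT.reachable
    · exact h.mono hle
  have hconn : T.Connected :=
    { preconnected := fun u v => (hreach u).trans (hreach v).symm
      nonempty := ⟨a⟩ }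
  -- Passing to a spanning tree of the exchanged graph avoids proving that this graph is acyclic;
  -- lengths are nonnegative, so dropping edges is harmless.
  obtain ⟨T', hT'le, hT'⟩ := hconn.exists_isTree_le
  have hmin := hM.2 T' hT'
  have hsub : T'.edgeFinset ⊆ insert s(x, b) (M.edgeFinset.erase s(a, b)) := by
    intro e
    induction e with
    | _ u v =>
      intro he
      have hadj : T.Adj u v := hT'le (by simpa using he)
      rcases hadj with h | h
      · have h' := (SimpleGraph.deleteEdges_adj).1 h
        refine Finset.mem_insert_of_mem (Finset.mem_erase.2 ⟨by simpa using h'.2, ?_⟩)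
        simpa using h'.1
      · rcases ((SimpleGraph.edge_adj _ _ _ _).1 h).1 with ⟨rfl, rfl⟩ | ⟨rfl, rfl⟩
        · simp
        · simp [Sym2.eq_swap]
  have hmem : s(a, b) ∈ M.edgeFinset := by simpa using hab
  have h1 : totalLength T' ≤ edgeLength s(x, b) + ∑ e ∈ M.edgeFinset.erase s(a, b), edgeLength e := by
    unfold totalLength
    refine (Finset.sum_le_sum_of_subset_of_nonneg hsub fun e _ _ => edgeLength_nonneg e).trans ?_
    by_cases h : s(x, b) ∈ M.edgeFinset.erase s(a, b)
    · rw [Finset.insert_eq_of_mem h]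
      linarith [edgeLength_nonneg s(x, b)]
    · rw [Finset.sum_insert h]
  have h2 : totalLength M = edgeLength s(a, b) +
      ∑ e ∈ M.edgeFinset.erase s(a, b), edgeLength e := by
    unfold totalLength
    exact (Finset.add_sum_erase _ _ hmem).symm
  have := edgeLength_mk a b
  have := edgeLength_mk x b
  linarith

lemma IsMST.luneFree {M : SimpleGraph S} (hM : IsMST M) : LuneFree M := by
  intro a b x hab
  have hside : ∀ v, (M.deleteEdges {s(a, b)}).Reachable v a ∨
      (M.deleteEdges {s(a, b)}).Reachable v b := by
    refine forall_of_connected hM.1.connected (a := a) (Or.inl (SimpleGraph.Reachable.refl a)) ?_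
    intro u v hu huv
    by_cases he : s(u, v) = s(a, b)
    · rcases Sym2.eq_iff.1 he with ⟨rfl, rfl⟩ | ⟨rfl, rfl⟩
      · exact Or.inr (SimpleGraph.Reachable.refl _)
      · exact Or.inl (SimpleGraph.Reachable.refl _)
    · have h : (M.deleteEdges {s(a, b)}).Adj v u :=
        (SimpleGraph.deleteEdges_adj.2 ⟨huv, by simpa using he⟩).symm
      exact hu.imp h.reachable.trans h.reachable.trans
  rcases hside x with h | h
  · exact Or.inr (hM.dist_le_of_reachable hab hside h)
  · left
    rw [Sym2.eq_swap] at hside h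
    rw [dist_comm]
    exact hM.dist_le_of_reachable hab.symm (fun v => (hside v).symm) h

/-! ### Edges, chords and gaps -/

lemma LuneFree.eq_vertex {M : SimpleGraph S} (hM : LuneFree M) {c a b x : S} (ha : M.Adj c a)
    (hb : M.Adj c b) (hx : (x : Plane) ∈ triangle (c : Plane) a b) : x = c ∨ x = a ∨ x = b := by
  rcases eq_vertex_of_mem_triangle hx (hM c a x ha) (hM c b x hb) with h | h | h
  · exact Or.inl (Subtype.ext h)
  · exact Or.inr (Or.inl (Subtype.ext h))
  · exact Or.inr (Or.inr (Subtype.ext h))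

lemma LuneFree.disjoint_edges {M : SimpleGraph S} (hM : LuneFree M) {a b c d : S} (hab : M.Adj a b)
    (hcd : M.Adj c d) (hac : a ≠ c) (had : a ≠ d) (hbc : b ≠ c) (hbd : b ≠ d) :
    Disjoint (segment ℝ (a : Plane) b) (segment ℝ (c : Plane) d) := by
  by_contra h
  obtain ⟨z, hz, hz'⟩ := Set.not_disjoint_iff.1 h
  rcases lune_of_crossing hz hz' (fun h => hac (Subtype.ext h)) (fun h => had (Subtype.ext h))
    (fun h => hbc (Subtype.ext h)) (fun h => hbd (Subtype.ext h)) with h | h | h | h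
  · rcases hM a b c hab with g | g <;> linarith [h.1, h.2]
  · rcases hM a b d hab with g | g <;> linarith [h.1, h.2]
  · rcases hM c d a hcd with g | g <;> linarith [h.1, h.2]
  · rcases hM c d b hcd with g | g <;> linarith [h.1, h.2]

/-- `a` and `b` are neighbours of `v` and no neighbour of `v` lies in the convex wedge between
them. -/
def Gap (M : SimpleGraph S) (v a b : S) : Prop :=
  M.Adj v a ∧ M.Adj v b ∧ a ≠ b ∧ ∀ w : S, M.Adj v w → ¬ InWedge (v : Plane) a b w

lemma Gap.symm {M : SimpleGraph S} {v a b : S} (h : Gap M v a b) : Gap M v b a :=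
  ⟨h.2.1, h.1, h.2.2.1.symm, fun w hw hw' => h.2.2.2 w hw hw'.symm⟩

/-- The chord between two neighbours of `v` crosses only edges at `v`. -/
lemma disjoint_chord_edge (hgen : GeneralPosition S) {M : SimpleGraph S} (hM : LuneFree M)
    {v a b c d : S} (hva : M.Adj v a) (hvb : M.Adj v b) (hne : a ≠ b) (hcd : M.Adj c d)
    (hac : a ≠ c) (had : a ≠ d) (hbc : b ≠ c) (hbd : b ≠ d)
    (hc : c = v → ¬ InWedge (v : Plane) a b d) (hd : d = v → ¬ InWedge (v : Plane) a b c) :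
    Disjoint (segment ℝ (a : Plane) b) (segment ℝ (c : Plane) d) := by
  have hD : orient (v : Plane) a b ≠ 0 := hgen.orient_ne hva.ne hvb.ne hne
  by_contra h
  rw [disjoint_comm] at h
  have key : ∀ d : S, M.Adj v d → a ≠ d → b ≠ d →
      ¬ Disjoint (segment ℝ (v : Plane) d) (segment ℝ (a : Plane) b) →
      InWedge (v : Plane) a b d := fun d hvd had hbd h =>
    inWedge_of_meet hD (hgen.orient_ne hvd.ne hvb.ne hbd.symm) (hgen.orient_ne hva.ne hvd.ne had) h
  by_cases hcv : c = v
  · subst hcv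
    exact hc rfl (key d hcd had hbd h)
  by_cases hdv : d = v
  · subst hdv
    rw [segment_symm] at h
    exact hd rfl (key c hcd.symm hac hbc h)
  have hnt : ∀ x : S, x ≠ v → a ≠ x → b ≠ x → (x : Plane) ∉ triangle (v : Plane) a b := by
    intro x h1 h2 h3 hx
    rcases hM.eq_vertex hva hvb hx with h | h | h
    · exact h1 h
    · exact h2 h.symm
    · exact h3 h.symm
  rcases meets_side hD (hgen.orient_ne hne hac hbc) (hnt c hcv hac hbc) (hnt d hdv had hbd) h
    with h | h
  · exact h (hM.disjoint_edges hcd hva hcv hac.symm hdv had.symm)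
  · exact h (hM.disjoint_edges hcd hvb hcv hbc.symm hdv hbd.symm)

lemma Gap.disjoint_edge (hgen : GeneralPosition S) {M : SimpleGraph S} (hM : LuneFree M)
    {v a b c d : S} (hg : Gap M v a b) (hcd : M.Adj c d)
    (hac : a ≠ c) (had : a ≠ d) (hbc : b ≠ c) (hbd : b ≠ d) :
    Disjoint (segment ℝ (a : Plane) b) (segment ℝ (c : Plane) d) := by
  refine disjoint_chord_edge hgen hM hg.1 hg.2.1 hg.2.2.1 hcd hac had hbc hbd ?_ ?_
  · rintro rfl; exact hg.2.2.2 d hcd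
  · rintro rfl; exact hg.2.2.2 c hcd.symm

/-- A gap edge and a chord around `w` cross only if `w` is an end of the gap edge. -/
lemma Gap.disjoint_chord (hgen : GeneralPosition S) {M : SimpleGraph S} (hM : LuneFree M)
    {v a b w c d : S} (hg : Gap M v a b) (hwc : M.Adj w c) (hwd : M.Adj w d) (hcd : c ≠ d)
    (hac : a ≠ c) (had : a ≠ d) (hbc : b ≠ c) (hbd : b ≠ d) (haw : a ≠ w) (hbw : b ≠ w) :
    Disjoint (segment ℝ (a : Plane) b) (segment ℝ (c : Plane) d) := by
  by_contra h
  have hnt : ∀ x : S, x ≠ w → x ≠ c → x ≠ d → (x : Plane) ∉ triangle (w : Plane) c d := by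
    intro x h1 h2 h3 hx
    rcases hM.eq_vertex hwc hwd hx with h | h | h
    · exact h1 h
    · exact h2 h
    · exact h3 h
  rcases meets_side (hgen.orient_ne hwc.ne hwd.ne hcd) (hgen.orient_ne hcd hac.symm had.symm)
    (hnt a haw hac had) (hnt b hbw hbc hbd) h with h | h
  · exact h (hg.disjoint_edge hgen hM hwc haw hac hbw hbc)
  · exact h (hg.disjoint_edge hgen hM hwd haw had hbw hbd)

/-- The gaps around `v` connect the neighbours of `v`. -/
lemma reachable_of_gap_le {M G : SimpleGraph S} {v : S} (hG : ∀ a b, Gap M v a b → G.Reachable a b)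
    {a b : S} (ha : M.Adj v a) (hb : M.Adj v b) : G.Reachable a b := by
  classical
  -- Induction on the number of neighbours inside the wedge: any such neighbour splits it into two
  -- wedges containing fewer.
  induction hn : (Finset.univ.filter fun w : S => M.Adj v w ∧ InWedge (v : Plane) a b w).card
    using Nat.strong_induction_on generalizing a b with
  | _ n ih =>
    by_cases hab : a = b
    · rw [hab]
    by_cases hex : ∃ w, M.Adj v w ∧ InWedge (v : Plane) a b w
    · obtain ⟨w, hw, hwin⟩ := hex
      have h1 : (Finset.univ.filter fun u : S => M.Adj v u ∧ InWedge (v : Plane) a w u).card < n := by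
        rw [← hn]
        refine Finset.card_lt_card (Finset.ssubset_iff_of_subset ?_ |>.2 ⟨w, ?_, ?_⟩)
        · intro u hu
          simp only [Finset.mem_filter, Finset.mem_univ, true_and] at hu ⊢
          exact ⟨hu.1, hwin.trans hu.2⟩
        · simp [hw, hwin]
        · simp [not_inWedge_self_right]
      have h2 : (Finset.univ.filter fun u : S => M.Adj v u ∧ InWedge (v : Plane) w b u).card < n := by
        rw [← hn]
        refine Finset.card_lt_card (Finset.ssubset_iff_of_subset ?_ |>.2 ⟨w, ?_, ?_⟩)
        · intro u hu
          simp only [Finset.mem_filter, Finset.mem_univ, true_and] at hu ⊢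
          exact ⟨hu.1, (hwin.symm.trans hu.2.symm).symm⟩
        · simp [hw, hwin]
        · simp [not_inWedge_self_left]
      exact (ih _ h1 ha hw rfl).trans (ih _ h2 hw hb rfl)
    · push Not at hex
      exact hG a b ⟨ha, hb, hab, hex⟩

/-! ### Non-crossing graphs -/

/-- Edges without a common endpoint are disjoint. -/
def NonCrossing (G : SimpleGraph S) : Prop :=
  ∀ a b c d : S, G.Adj a b → G.Adj c d → a ≠ c → a ≠ d → b ≠ c → b ≠ d →
    Disjoint (segment ℝ (a : Plane) b) (segment ℝ (c : Plane) d)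

lemma NonCrossing.mono {G H : SimpleGraph S} (hH : NonCrossing H) (h : G ≤ H) : NonCrossing G :=
  fun a b c d hab hcd => hH a b c d (h hab) (h hcd)

lemma NonCrossing.sup_edge {G : SimpleGraph S} (hG : NonCrossing G) {u v : S}
    (h : ∀ a b, G.Adj a b → a ≠ u → a ≠ v → b ≠ u → b ≠ v →
      Disjoint (segment ℝ (a : Plane) b) (segment ℝ (u : Plane) v)) :
    NonCrossing (G ⊔ SimpleGraph.edge u v) := by
  intro a b c d hab hcd hac had hbc hbd
  rw [SimpleGraph.sup_adj, SimpleGraph.edge_adj] at hab hcd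
  rcases hab with hab | ⟨⟨rfl, rfl⟩ | ⟨rfl, rfl⟩, -⟩ <;>
    rcases hcd with hcd | ⟨⟨rfl, rfl⟩ | ⟨rfl, rfl⟩, -⟩
  · exact hG a b c d hab hcd hac had hbc hbd
  · exact h a b hab hac had hbc hbd
  · rw [segment_symm ℝ (c : Plane)]
    exact h a b hab had hac hbd hbc
  · exact (h c d hcd hac.symm hbc.symm had.symm hbd.symm).symm
  · exact absurd rfl hac
  · exact absurd rfl had
  · rw [segment_symm ℝ (a : Plane)]
    exact (h c d hcd hbc.symm hac.symm hbd.symm had.symm).symm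
  · exact absurd rfl had
  · exact absurd rfl hac

lemma eq_of_mem_segments (hgen : GeneralPosition S) {a b c : S} (hab : a ≠ b) (hac : a ≠ c)
    (hbc : b ≠ c) {z : Plane} (h1 : z ∈ segment ℝ (a : Plane) b)
    (h2 : z ∈ segment ℝ (a : Plane) c) : z = a := by
  obtain ⟨t, -, -, hx, hy⟩ := mem_segment_coord.1 h1
  obtain ⟨s, -, -, hs⟩ := orient_of_mem_segment h2
  have ht : orient (a : Plane) c z = t * orient (a : Plane) c b := by
    unfold orient; rw [hx, hy]; ring
  rw [hs] at ht
  simp only [orient_self_outer, orient_self_right, mul_zero, add_zero] at ht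
  have : t = 0 := (mul_eq_zero.1 ht.symm).resolve_right (hgen.orient_ne hac hab hbc.symm)
  subst this
  exact plane_ext (by simp [hx]) (by simp [hy])

lemma NonCrossing.isPlane (hgen : GeneralPosition S) {G : SimpleGraph S} (hG : NonCrossing G) :
    IsPlane G := by
  rintro a b c d hab hcd hne z ⟨hz, hz'⟩
  by_cases hac : a = c
  · subst hac
    have hbd : b ≠ d := fun h => hne (by rw [h])
    simp [eq_of_mem_segments hgen hab.ne hcd.ne hbd hz hz']
  by_cases had : a = d
  · subst had
    have hbc : b ≠ c := fun h => hne (by rw [h, Sym2.eq_swap])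
    rw [segment_symm] at hz'
    simp [eq_of_mem_segments hgen hab.ne hcd.ne.symm hbc hz hz']
  by_cases hbc : b = c
  · subst hbc
    rw [segment_symm] at hz
    simp [eq_of_mem_segments hgen hab.ne.symm hcd.ne had hz hz']
  by_cases hbd : b = d
  · subst hbd
    rw [segment_symm] at hz hz'
    simp [eq_of_mem_segments hgen hab.ne.symm hcd.ne.symm hac hz hz']
  exact absurd (Set.not_disjoint_iff.2 ⟨z, hz, hz'⟩)
    (not_not.2 (hG a b c d hab hcd hac had hbc hbd))

/-! ### Levels in a rooted tree -/

section Levels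

variable {V : Type*} {M : SimpleGraph V}

lemma exists_parent (hM : M.IsTree) (r : V) {v : V} (hv : v ≠ r) :
    ∃ p, M.Adj p v ∧ M.dist r v = M.dist r p + 1 := by
  obtain ⟨w, hw⟩ := hM.connected.exists_walk_length_eq_dist v r
  cases w with
  | nil => exact absurd rfl hv
  | @cons _ p _ h q =>
    refine ⟨p, h.symm, ?_⟩
    have h1 := SimpleGraph.dist_le q
    rw [SimpleGraph.Walk.length_cons] at hw
    rw [SimpleGraph.dist_comm (u := r), SimpleGraph.dist_comm (u := r)]
    rcases hM.dist_eq_dist_add_one_of_adj r h with h2 | h2 <;>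
      rw [SimpleGraph.dist_comm (u := r), SimpleGraph.dist_comm (u := r)] at h2 <;> omega

lemma dist_parity (hM : M.IsTree) (r : V) {u v : V} (h : M.Adj u v) :
    (M.dist r u + M.dist r v) % 2 = 1 := by
  rcases hM.dist_eq_dist_add_one_of_adj r h with h2 | h2 <;> omega

lemma dist_eq_two (hM : M.IsTree) {r c g : V} (hrc : M.Adj r c) (hcg : M.Adj c g) (hgr : g ≠ r) :
    M.dist r g = 2 := by
  have h1 : M.dist r c = 1 := SimpleGraph.dist_eq_one_iff_adj.2 hrc
  have h0 : M.dist r g ≠ 0 := fun h => hgr ((hM.connected.dist_eq_zero_iff).1 h).symm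
  rcases hM.dist_eq_dist_add_one_of_adj r hcg with h2 | h2 <;> omega

/-- Geodesics to $u$ and $w$, each extended by the edge to $v$, are two paths from $s$ to $v$, which
coincide in a tree. -/
lemma parent_unique (hM : M.IsTree) (s : V) {u w v : V} (hu : M.Adj u v) (hw : M.Adj w v)
    (hdu : M.dist s v = M.dist s u + 1) (hdw : M.dist s v = M.dist s w + 1) : u = w := by
  obtain ⟨p, hp⟩ := hM.connected.exists_walk_length_eq_dist s u
  obtain ⟨q, hq⟩ := hM.connected.exists_walk_length_eq_dist s w
  have hp' : (p.concat hu).IsPath := SimpleGraph.Walk.isPath_of_length_eq_dist _ (by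
    rw [SimpleGraph.Walk.length_concat]; omega)
  have hq' : (q.concat hw).IsPath := SimpleGraph.Walk.isPath_of_length_eq_dist _ (by
    rw [SimpleGraph.Walk.length_concat]; omega)
  have := (hM.existsUnique_path s v).unique hp' hq'
  obtain ⟨h, -⟩ := SimpleGraph.Walk.concat_inj this
  exact h

/-- A nontrivial finite tree has a leaf whose neighbour has at most one neighbour that is not a
leaf. -/
lemma exists_leaf_cluster [Finite V] [Nontrivial V] (hM : M.IsTree) :
    ∃ c r, M.Adj c r ∧ (∀ u, M.Adj r u → u = c) ∧
      ∀ h h', M.Adj c h → M.Adj c h' → ¬ (∀ u, M.Adj h u → u = c) →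
        ¬ (∀ u, M.Adj h' u → u = c) → h = h' := by
  obtain ⟨s⟩ : Nonempty V := inferInstance
  -- For a deepest vertex $r$ with parent $c$, every child of $c$ is also deepest and hence a leaf;
  -- only the parent of $c$ can be a non-leaf.
  obtain ⟨r, hr⟩ := Finite.exists_max (fun v => M.dist s v)
  have hrs : r ≠ s := by
    rintro rfl
    obtain ⟨v, hv⟩ := exists_ne r
    have h := hr v
    have := hM.connected.pos_dist_of_ne hv.symm
    simp only [SimpleGraph.dist_self] at h
    omega
  obtain ⟨c, hc, hcd⟩ := exists_parent hM s hrs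
  have hleaf : ∀ h, M.Adj c h → M.dist s h = M.dist s c + 1 → ∀ u, M.Adj h u → u = c := by
    intro h hch hd u hu
    refine parent_unique hM s hu.symm hch ?_ hd
    rcases hM.dist_eq_dist_add_one_of_adj s hu with h2 | h2
    · exact h2
    · have := hr u
      omega
  refine ⟨c, r, hc, hleaf r hc hcd, ?_⟩
  intro h h' hh hh' n n'
  have key : ∀ x, M.Adj c x → ¬ (∀ u, M.Adj x u → u = c) → M.dist s c = M.dist s x + 1 := by
    intro x hx hn
    rcases hM.dist_eq_dist_add_one_of_adj s hx with h2 | h2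
    · exact h2
    · exact absurd (hleaf x hx h2) hn
  exact parent_unique hM s hh.symm hh'.symm (key h hh n) (key h' hh' n')

end Levels

/-! ### The two layers -/

/-- The tree edges whose lower end has the parity of `k + 1`, together with the gaps around the
vertices of that parity. -/
def layer (M : SimpleGraph S) (r : S) (k : ℕ) : SimpleGraph S where
  Adj a b := (M.Adj a b ∧ Even (min (M.dist r a) (M.dist r b) + k)) ∨
    ∃ v, Odd (M.dist r v + k) ∧ Gap M v a b
  symm := ⟨by
    rintro a b (⟨h, h'⟩ | ⟨v, hv, h⟩)
    · exact Or.inl ⟨h.symm, by rwa [min_comm]⟩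
    · exact Or.inr ⟨v, hv, h.symm⟩⟩
  loopless := ⟨by
    rintro a (⟨h, -⟩ | ⟨v, -, h⟩)
    · exact h.ne rfl
    · exact h.2.2.1 rfl⟩

lemma layer_adj {M : SimpleGraph S} {r : S} {k : ℕ} {a b : S} : (layer M r k).Adj a b ↔
    (M.Adj a b ∧ Even (min (M.dist r a) (M.dist r b) + k)) ∨
      ∃ v, Odd (M.dist r v + k) ∧ Gap M v a b := Iff.rfl

lemma layer_disjoint_edge (hgen : GeneralPosition S) {M : SimpleGraph S} (hL : LuneFree M)
    {r : S} {k : ℕ} {a b c d : S} (hab : (layer M r k).Adj a b) (hcd : M.Adj c d)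
    (hac : a ≠ c) (had : a ≠ d) (hbc : b ≠ c) (hbd : b ≠ d) :
    Disjoint (segment ℝ (a : Plane) b) (segment ℝ (c : Plane) d) := by
  rcases layer_adj.1 hab with ⟨h, -⟩ | ⟨v, -, h⟩
  · exact hL.disjoint_edges h hcd hac had hbc hbd
  · exact h.disjoint_edge hgen hL hcd hac had hbc hbd

/-- Two gaps in one layer have centres of equal parity, and gap ends have the other parity, so no
end of one gap is the centre of the other. -/
lemma layer_nonCrossing (hgen : GeneralPosition S) {M : SimpleGraph S} (hT : M.IsTree)
    (hL : LuneFree M) (r : S) (k : ℕ) : NonCrossing (layer M r k) := by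
  intro a b c d hab hcd hac had hbc hbd
  rcases layer_adj.1 hcd with ⟨h, -⟩ | ⟨w, hw, h⟩
  · exact layer_disjoint_edge hgen hL hab h hac had hbc hbd
  rcases layer_adj.1 hab with ⟨h', -⟩ | ⟨v, hv, h'⟩
  · exact (h.disjoint_edge hgen hL h' hac.symm hbc.symm had.symm hbd.symm).symm
  · have hne : ∀ x, M.Adj v x → x ≠ w := by
      rintro x hx rfl
      have := dist_parity hT r hx
      rw [Nat.odd_iff] at hv hw
      omega
    exact h'.disjoint_chord hgen hL h.1 h.2.1 h.2.2.1 hac had hbc hbd (hne a h'.1) (hne b h'.2.1)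

lemma Gap.parity {M : SimpleGraph S} (hT : M.IsTree) (r : S) {v a b : S} (h : Gap M v a b) :
    (M.dist r v + M.dist r a) % 2 = 1 ∧ (M.dist r v + M.dist r b) % 2 = 1 :=
  ⟨dist_parity hT r h.1, dist_parity hT r h.2.1⟩

/-- Tree edges join opposite parities and gaps join equal ones; within each kind, the parity of the
upper end or of the centre separates the layers. -/
lemma layers_disjoint {M : SimpleGraph S} (hT : M.IsTree) {r : S} {a b : S}
    (h0 : (layer M r 0).Adj a b) (h1 : (layer M r 1).Adj a b) : False := by
  rcases layer_adj.1 h0 with ⟨h, h'⟩ | ⟨v, hv, h⟩ <;>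
    rcases layer_adj.1 h1 with ⟨g, g'⟩ | ⟨w, hw, g⟩
  · rw [Nat.even_iff] at h' g'; omega
  · have := dist_parity hT r h
    have := g.parity hT r
    omega
  · have := dist_parity hT r g
    have := h.parity hT r
    omega
  · have := h.parity hT r
    have := g.parity hT r
    rw [Nat.odd_iff] at hv hw
    omega

lemma dist_le_two_mul {M : SimpleGraph S} {β : ℝ}
    (hβ : ∀ a b : S, M.Adj a b → dist (a : Plane) b ≤ β) {v a b : S} (ha : M.Adj v a)
    (hb : M.Adj v b) : dist (a : Plane) b ≤ 2 * β := by
  have := dist_triangle (a : Plane) v b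
  have := hβ a v ha.symm
  have := hβ v b hb
  linarith

lemma layer_dist_le {M : SimpleGraph S} {β : ℝ}
    (hβ : ∀ a b : S, M.Adj a b → dist (a : Plane) b ≤ β) {r : S} {k : ℕ} {a b : S}
    (h : (layer M r k).Adj a b) : dist (a : Plane) b ≤ 2 * β := by
  rcases layer_adj.1 h with ⟨h, -⟩ | ⟨v, -, h⟩
  · have := hβ a b h
    have : (0 : ℝ) ≤ dist (a : Plane) b := dist_nonneg
    linarith
  · exact dist_le_two_mul hβ h.1 h.2.1

/-- Odd vertices go to their parent, even ones to their grandparent through the gaps around the odd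
parent. -/
lemma reachable_root {M G : SimpleGraph S} (hT : M.IsTree) {r : S}
    (hgap : ∀ v a b, Odd (M.dist r v) → Gap M v a b → G.Reachable a b)
    (hpar : ∀ v p, M.Adj p v → M.dist r v = M.dist r p + 1 → Odd (M.dist r v) → G.Reachable v p)
    (v : S) : G.Reachable v r := by
  induction hn : M.dist r v using Nat.strong_induction_on generalizing v with
  | _ n ih =>
    by_cases hv : v = r
    · rw [hv]
    obtain ⟨p, hp, hpd⟩ := exists_parent hT r hv
    rcases Nat.even_or_odd (M.dist r v) with he | ho
    · have hpo : Odd (M.dist r p) := by rw [Nat.even_iff] at he; rw [Nat.odd_iff]; omega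
      have hpr : p ≠ r := by rintro rfl; simp at hpo
      obtain ⟨q, hq, hqd⟩ := exists_parent hT r hpr
      exact (reachable_of_gap_le (fun a b => hgap p a b hpo) hp hq.symm).trans
        (ih _ (by omega) q rfl)
    · exact (hpar v p hp hpd ho).trans (ih _ (by omega) p rfl)

/-- The counterpart for layer 1. After at most one parent step the recursion visits only odd
vertices and stops at $c$, the only child of $r$. Thus `P` concerns the starting vertex alone and
can exempt an even vertex whose parent edge is missing. -/
lemma reachable_center {M G : SimpleGraph S} (hT : M.IsTree) {r c : S}
    (hr : ∀ u, M.Adj r u → u = c) {P : S → Prop}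
    (hgap : ∀ v a b, Even (M.dist r v) → Gap M v a b → G.Reachable a b)
    (hpar : ∀ v p, P v → M.Adj p v → M.dist r v = M.dist r p + 1 → Even (M.dist r v) →
      G.Reachable v p)
    (v : S) (hv : v ≠ r) (hP : Even (M.dist r v) → P v) : G.Reachable v c := by
  induction hn : M.dist r v using Nat.strong_induction_on generalizing v with
  | _ n ih =>
    obtain ⟨p, hp, hpd⟩ := exists_parent hT r hv
    rcases Nat.even_or_odd (M.dist r v) with he | ho
    · have hpo : Odd (M.dist r p) := by rw [Nat.even_iff] at he; rw [Nat.odd_iff]; omega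
      have hpr : p ≠ r := by rintro rfl; simp at hpo
      exact (hpar v p (hP he) hp hpd he).trans
        (ih _ (by omega) p hpr (fun h => absurd hpo (Nat.not_odd_iff_even.2 h)) rfl)
    · have hpe : Even (M.dist r p) := by rw [Nat.odd_iff] at ho; rw [Nat.even_iff]; omega
      by_cases hpr : p = r
      · subst hpr
        rw [hr v hp]
      obtain ⟨q, hq, hqd⟩ := exists_parent hT r hpr
      have hqo : Odd (M.dist r q) := by rw [Nat.even_iff] at hpe; rw [Nat.odd_iff]; omega
      have hqr : q ≠ r := by rintro rfl; simp at hqo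
      exact (reachable_of_gap_le (fun a b => hgap p a b hpe) hp hq.symm).trans
        (ih _ (by omega) q hqr (fun h => absurd hqo (Nat.not_odd_iff_even.2 h)) rfl)

lemma connected_of_reachable {G : SimpleGraph S} (r : S) (h : ∀ v, G.Reachable v r) :
    G.Connected :=
  { preconnected := fun u v => (h u).trans (h v).symm
    nonempty := ⟨r⟩ }

/-- Two edge-disjoint connected non-crossing graphs with the required bounds on edge lengths. -/
def HasLayerPair (S : Finset Plane) (β : ℝ) : Prop :=
  ∃ R B : SimpleGraph S, R.Connected ∧ B.Connected ∧ NonCrossing R ∧ NonCrossing B ∧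
    (∀ a b, R.Adj a b → ¬ B.Adj a b) ∧
    ∃ e : Sym2 S, ∀ a b, R.Adj a b ∨ B.Adj a b →
      dist (a : Plane) b ≤ 2 * β ∨ (s(a, b) = e ∧ dist (a : Plane) b ≤ 3 * β)

/-! ### Choosing the root -/

lemma meet_of_inWedge {v a b d : Plane} (hD : orient v a b ≠ 0) (hw : InWedge v a b d)
    (hd : d ∉ triangle v a b) : ¬ Disjoint (segment ℝ v d) (segment ℝ a b) := by
  obtain ⟨α, s, t, hsum, h0, h1, -, hs, ht⟩ := bary hD d
  have hpos : 0 < orient v a b * orient v a b := mul_self_pos.2 hD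
  have hs' : 0 < s := by
    have h := hw.1
    rw [← orient_rotate v d b, ← orient_rotate d b v, ← hs, mul_assoc] at h
    exact pos_of_mul_pos_left h hpos.le
  have ht' : 0 < t := by
    have h := hw.2
    rw [← ht, mul_assoc] at h
    exact pos_of_mul_pos_left h hpos.le
  have hα : α < 0 := by
    by_contra! hα
    exact hd (mem_triangle_coord.2 ⟨α, s, t, hα, hs'.le, ht'.le, hsum, h0, h1⟩)
  obtain rfl : α = 1 - s - t := by linarith
  have hst : 0 < s + t := by linarith
  refine Set.not_disjoint_iff.2 ⟨!₂[(s * a 0 + t * b 0) / (s + t), (s * a 1 + t * b 1) / (s + t)],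
    mem_segment_coord.2 ⟨1 / (s + t), by positivity, ?_, ?_, ?_⟩,
    mem_segment_coord.2 ⟨t / (s + t), by positivity, ?_, ?_, ?_⟩⟩
  · rw [div_le_one hst]; linarith
  · simp [h0]; field_simp; ring
  · simp [h1]; field_simp; ring
  · rw [div_le_one hst]; linarith
  · simp; field_simp; ring
  · simp; field_simp; ring

/-- Two angularly neighbouring leaves `h₁`, `h₂` at `c`, followed by a third neighbour `h₃`. -/
lemma hasLayerPair_of_two_leaves (hgen : GeneralPosition S) {M : SimpleGraph S} (hT : M.IsTree)
    (hL : LuneFree M) {β : ℝ} (hβ : ∀ a b : S, M.Adj a b → dist (a : Plane) b ≤ β)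
    {c h₁ h₂ h₃ : S} (hl₁ : ∀ u, M.Adj h₁ u → u = c) (hl₂ : ∀ u, M.Adj h₂ u → u = c)
    (g₁₂ : Gap M c h₁ h₂) (g₂₃ : Gap M c h₂ h₃) (h₁₃ : h₁ ≠ h₃)
    (hw : ∀ w, M.Adj c w → InWedge (c : Plane) h₁ h₃ w → w = h₂) : HasLayerPair S β := by
  have hc1 : M.Adj c h₁ := g₁₂.1
  have hc2 : M.Adj c h₂ := g₁₂.2.1
  have hc3 : M.Adj c h₃ := g₂₃.2.1
  have h₁₂ : h₁ ≠ h₂ := g₁₂.2.2.1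
  have h₂₃ : h₂ ≠ h₃ := g₂₃.2.2.1
  have dc : M.dist h₁ c = 1 := SimpleGraph.dist_eq_one_iff_adj.2 hc1.symm
  have d2 : M.dist h₁ h₂ = 2 := dist_eq_two hT hc1.symm hc2 h₁₂.symm
  -- The gap $h_1h_2$ moves to the other layer, where it attaches the root $h_1$; in `R` the path
  -- $h_1h_3h_2$ replaces it.
  set R := (layer M h₁ 0 \ SimpleGraph.edge h₁ h₂) ⊔ SimpleGraph.edge h₁ h₃ with hR
  set B := layer M h₁ 1 ⊔ SimpleGraph.edge h₁ h₂ with hB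
  have hR13 : R.Adj h₁ h₃ := by simp [hR, SimpleGraph.edge_adj, h₁₃]
  have hR32 : R.Adj h₃ h₂ := by
    refine Or.inl ⟨layer_adj.2 (Or.inr ⟨c, by simp [dc], g₂₃.symm⟩), ?_⟩
    rw [SimpleGraph.edge_adj]
    rintro ⟨⟨rfl, -⟩ | ⟨rfl, -⟩, -⟩
    · exact h₁₃ rfl
    · exact h₂₃ rfl
  have hB12 : B.Adj h₁ h₂ := by simp [hB, SimpleGraph.edge_adj, h₁₂]
  have hR12 : R.Reachable h₁ h₂ := hR13.reachable.trans hR32.reachable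
  have hRlayer : ∀ a b, (layer M h₁ 0).Adj a b → R.Reachable a b := by
    intro a b hab
    by_cases he : (SimpleGraph.edge h₁ h₂).Adj a b
    · rw [SimpleGraph.edge_adj] at he
      rcases he.1 with ⟨rfl, rfl⟩ | ⟨rfl, rfl⟩
      · exact hR12
      · exact hR12.symm
    · exact SimpleGraph.Adj.reachable (Or.inl ⟨hab, he⟩)
  refine ⟨R, B, ?_, ?_, ?_, ?_, ?_, s(h₁, h₂), ?_⟩
  · refine connected_of_reachable h₁ (reachable_root hT ?_ ?_)
    · exact fun v a b hv hg => hRlayer a b (Or.inr ⟨v, by simpa using hv, hg⟩)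
    · refine fun v p hp hd ho => hRlayer v p (Or.inl ⟨hp.symm, ?_⟩)
      rw [Nat.odd_iff] at ho
      rw [Nat.even_iff, hd]
      omega
  · have hle : layer M h₁ 1 ≤ B := le_sup_left
    have key : ∀ v, v ≠ h₁ → B.Reachable v c := fun v hv =>
      reachable_center hT hl₁ (P := fun _ => True)
        (fun v a b hv hg => (SimpleGraph.Adj.reachable
          (hle (Or.inr ⟨v, hv.add_one, hg⟩))))
        (fun v p _ hp hd he => by
          refine SimpleGraph.Adj.reachable (hle (Or.inl ⟨hp.symm, ?_⟩))
          rw [Nat.even_iff] at he ⊢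
          omega) v hv (fun _ => trivial)
    refine connected_of_reachable c fun v => ?_
    by_cases hv : v = h₁
    · rw [hv]
      exact hB12.reachable.trans (key h₂ h₁₂.symm)
    · exact key v hv
  · refine NonCrossing.sup_edge ((layer_nonCrossing hgen hT hL h₁ 0).mono sdiff_le) ?_
    rintro a b ⟨hab, -⟩ ha1 ha3 hb1 hb3
    -- The only tree edge that $h_1h_3$ can cross is $ch_2$, whose upper end has depth 1, so it
    -- belongs to the other layer.
    rcases layer_adj.1 hab with ⟨h, he⟩ | ⟨w, hw', hg⟩
    · refine (disjoint_chord_edge hgen hL hc1 hc3 h₁₃ h ha1.symm hb1.symm ha3.symm hb3.symm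
        ?_ ?_).symm
      · rintro rfl hin
        obtain rfl := hw b h hin
        simp [dc, d2] at he
      · rintro rfl hin
        obtain rfl := hw a h.symm hin
        simp [dc, d2] at he
    · have hne : ∀ x, M.Adj w x → x ≠ c := by
        rintro x hx rfl
        have := dist_parity hT h₁ hx
        rw [Nat.odd_iff] at hw'
        omega
      exact hg.disjoint_chord hgen hL hc1 hc3 h₁₃ ha1 ha3 hb1 hb3 (hne a hg.1) (hne b hg.2.1)
  · refine NonCrossing.sup_edge (layer_nonCrossing hgen hT hL h₁ 1) ?_
    intro a b hab ha1 ha2 hb1 hb2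
    rcases layer_adj.1 hab with ⟨h, -⟩ | ⟨w, hw', hg⟩
    · exact (g₁₂.disjoint_edge hgen hL h ha1.symm hb1.symm ha2.symm hb2.symm).symm
    · refine (g₁₂.disjoint_chord hgen hL hg.1 hg.2.1 hg.2.2.1 ha1.symm hb1.symm ha2.symm hb2.symm
        ?_ ?_).symm
      · rintro rfl
        exact hg.2.2.1 ((hl₁ a hg.1).trans (hl₁ b hg.2.1).symm)
      · rintro rfl
        exact hg.2.2.1 ((hl₂ a hg.1).trans (hl₂ b hg.2.1).symm)
  · have h13 : ¬ (layer M h₁ 1).Adj h₁ h₃ := by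
      rintro (⟨h, -⟩ | ⟨w, hw', hg⟩)
      · exact hc3.ne (hl₁ _ h).symm
      · obtain rfl := hl₁ w hg.1.symm
        rw [dc] at hw'
        exact absurd hw' (by decide)
    rintro a b (⟨h, h'⟩ | h) (g | g)
    · exact layers_disjoint hT h g
    · exact h' g
    · rcases ((SimpleGraph.edge_adj _ _ _ _).1 h).1 with ⟨rfl, rfl⟩ | ⟨rfl, rfl⟩
      · exact h13 g
      · exact h13 g.symm
    · rcases ((SimpleGraph.edge_adj _ _ _ _).1 h).1 with ⟨rfl, rfl⟩ | ⟨rfl, rfl⟩ <;>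
        rcases ((SimpleGraph.edge_adj _ _ _ _).1 g).1 with ⟨h, h'⟩ | ⟨h, h'⟩ <;>
        simp_all
  · intro a b hab
    left
    have hedge : ∀ x y, M.Adj c x → M.Adj c y → (SimpleGraph.edge x y).Adj a b →
        dist (a : Plane) b ≤ 2 * β := by
      intro x y hx hy h
      rcases ((SimpleGraph.edge_adj _ _ _ _).1 h).1 with ⟨rfl, rfl⟩ | ⟨rfl, rfl⟩
      · exact dist_le_two_mul hβ hx hy
      · exact dist_le_two_mul hβ hy hx
    rcases hab with (⟨h, -⟩ | h) | (h | h)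
    · exact layer_dist_le hβ h
    · exact hedge _ _ hc1 hc3 h
    · exact layer_dist_le hβ h
    · exact hedge _ _ hc1 hc2 h

lemma dist_le_three_mul {M : SimpleGraph S} {β : ℝ}
    (hβ : ∀ a b : S, M.Adj a b → dist (a : Plane) b ≤ β) {a b c d : S} (hab : M.Adj a b)
    (hbc : M.Adj b c) (hcd : M.Adj c d) : dist (a : Plane) d ≤ 3 * β := by
  have := dist_triangle (a : Plane) c d
  have := dist_le_two_mul hβ hab.symm hbc
  have := hβ c d hcd
  linarith

/-- On one side of the edge `c g`, at most one gap at `g` starts with `c`. -/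
lemma Gap.eq_of_same_side (hgen : GeneralPosition S) {M : SimpleGraph S} {g c x b : S}
    (hx : Gap M g c x) (hb : Gap M g c b)
    (h : 0 < orient (c : Plane) g x * orient (c : Plane) g b) : b = x := by
  by_contra hne
  have e : ∀ w : Plane, orient (g : Plane) c w = - orient (c : Plane) g w := by
    intro w; unfold orient; ring
  rcases inWedge_or_of_same_side (v := (g : Plane)) (g := c) (a := x) (b := b)
    (by rw [e, e]; linarith)
    (hgen.orient_ne hx.2.1.ne hb.2.1.ne (Ne.symm hne)) with h | h
  · exact hx.2.2.2 b hb.2.1 h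
  · exact hb.2.2.2 x hx.2.1 h

/-- A path `r c g x` turning twice to the same side, where `r` is a leaf. -/
lemma hasLayerPair_of_same_turn (hgen : GeneralPosition S) {M : SimpleGraph S} (hT : M.IsTree)
    (hL : LuneFree M) {β : ℝ} (hβ : ∀ a b : S, M.Adj a b → dist (a : Plane) b ≤ β)
    {r c g x : S} (hr : ∀ u, M.Adj r u → u = c) (hrg : Gap M c r g) (hcx : Gap M g c x)
    (hside : 0 < orient (c : Plane) g r * orient (c : Plane) g x)
    (hleaf : ∀ h, M.Adj c h → h ≠ g → ∀ u, M.Adj h u → u = c) : HasLayerPair S β := by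
  have hcr : M.Adj c r := hrg.1
  have hcg : M.Adj c g := hrg.2.1
  have hgx : M.Adj g x := hcx.2.1
  have hcx' : c ≠ x := hcx.2.2.1
  have dc : M.dist r c = 1 := SimpleGraph.dist_eq_one_iff_adj.2 hcr.symm
  have dg : M.dist r g = 2 := dist_eq_two hT hcr.symm hcg hrg.2.2.1.symm
  have dx : M.dist r x % 2 = 1 := by
    have := dist_parity hT r hgx
    omega
  have hrx : r ≠ x := by rintro rfl; simp at dx
  have hcx_adj : ¬ M.Adj c x := by
    intro h
    have := dist_parity hT r h
    omega
  -- If instead $r$ were angularly between $g$ and $x$, then, as the triangle $cgx$ is empty, the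
  -- tree edges $cr$ and $gx$ would cross.
  have hwx : InWedge (c : Plane) r g x := by
    rcases inWedge_or_of_same_side hside (hgen.orient_ne hcr.ne hcx' hrx) with h | h
    · exact h.symm
    · exfalso
      refine meet_of_inWedge (hgen.orient_ne hcg.ne hcx' hgx.ne) h ?_
        (hL.disjoint_edges hcr hgx hcg.ne hcx' hrg.2.2.1 hrx)
      intro hmem
      rw [triangle_swap_left] at hmem
      rcases hL.eq_vertex hcg.symm hgx hmem with h | h | h
      · exact hrg.2.2.1 h
      · exact hcr.ne h.symm
      · exact hrx h
  have hcxB : (layer M r 1).Adj c x := Or.inr ⟨g, by rw [dg]; decide, hcx⟩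
  obtain ⟨y, hyr, hyc, hyt, hvis⟩ := exists_visible hgen (layer M r 1) hcr.ne.symm hrx hcx'
    (fun a b hab ha hb ha' hb' => layer_disjoint_edge hgen hL hab hcr.symm ha ha' hb hb')
    (fun a b hab _ _ ha hb ha' hb' =>
      layer_nonCrossing hgen hT hL r 1 a b c x hab hcxB ha ha' hb hb')
    (by
      rintro b (⟨h, -⟩ | ⟨w, hw, hg⟩) hbr
      -- Tree edges at $c$ avoid the wedge of the gap $rg$. Chords ending at $c$ are centred at a
      -- neighbour of $c$; leaves carry no gaps, and on this side of $cg$ the only gap around $g$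
      -- from $c$ is $cx$.
      · exact Or.inr fun hin => hrg.2.2.2 b h (hwx.trans hin)
      · by_cases hwg : w = g
        · subst hwg
          by_contra! hcon
          have hin := (hwx.trans hcon.2).symm
          refine hcon.1 (hcx.eq_of_same_side hgen hg ?_)
          have h1 := hin.2
          have h2 : 0 < orient (c : Plane) w r * orient (c : Plane) w r :=
            mul_self_pos.2 (hgen.orient_ne hcg.ne hcr.ne hrg.2.2.1.symm)
          refine pos_of_mul_pos_left (b := orient (c : Plane) w r * orient (c : Plane) w r) ?_ h2.le
          have := mul_pos hside h1
          linarith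
        · exact absurd (hleaf w hg.1.symm hwg b hg.2.1).symm hg.2.2.1)
  have hyR : ¬ (layer M r 0).Adj r y := by
    rintro (⟨h, -⟩ | ⟨w, -, hg⟩)
    · exact hyc (hr y h)
    · obtain rfl := hr w hg.1.symm
      have hyx : y ≠ x := by rintro rfl; exact hcx_adj hg.2.1
      refine hrg.2.2.2 y hg.2.1 (hwx.trans (inWedge_of_mem_triangle (by rwa [triangle_swap_left])
        (hgen.orient_ne hcr.ne hcx' hrx) (hgen.orient_ne hyc.symm hcx' hyx)
        (hgen.orient_ne hcr.ne hyc.symm hyr.symm)))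
  refine ⟨layer M r 0, layer M r 1 ⊔ SimpleGraph.edge r y, ?_, ?_,
    layer_nonCrossing hgen hT hL r 0, ?_, ?_, s(r, y), ?_⟩
  · refine connected_of_reachable r (reachable_root hT ?_ ?_)
    · exact fun v a b hv hg => SimpleGraph.Adj.reachable (Or.inr ⟨v, by simpa using hv, hg⟩)
    · refine fun v p hp hd ho => SimpleGraph.Adj.reachable (Or.inl ⟨hp.symm, ?_⟩)
      rw [Nat.odd_iff] at ho
      rw [Nat.even_iff, hd]
      omega
  · have hle : layer M r 1 ≤ layer M r 1 ⊔ SimpleGraph.edge r y := le_sup_left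
    have key : ∀ v, v ≠ r → (layer M r 1 ⊔ SimpleGraph.edge r y).Reachable v c := fun v hv =>
      reachable_center hT hr (P := fun _ => True)
        (fun v a b hv hg => (SimpleGraph.Adj.reachable
          (hle (Or.inr ⟨v, hv.add_one, hg⟩))))
        (fun v p _ hp hd he => by
          refine SimpleGraph.Adj.reachable (hle (Or.inl ⟨hp.symm, ?_⟩))
          rw [Nat.even_iff] at he ⊢
          omega) v hv (fun _ => trivial)
    refine connected_of_reachable c fun v => ?_
    by_cases hv : v = r
    · rw [hv]
      refine SimpleGraph.Reachable.trans (SimpleGraph.Adj.reachable (Or.inr ?_)) (key y hyr)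
      exact (SimpleGraph.edge_adj _ _ _ _).2 ⟨Or.inl ⟨rfl, rfl⟩, hyr.symm⟩
    · exact key v hv
  · exact NonCrossing.sup_edge (layer_nonCrossing hgen hT hL r 1)
      fun a b hab har hay hbr hby => hvis a b hab har hbr hay hby
  · rintro a b h (h' | h')
    · exact layers_disjoint hT h h'
    · rcases ((SimpleGraph.edge_adj _ _ _ _).1 h').1 with ⟨rfl, rfl⟩ | ⟨rfl, rfl⟩
      · exact hyR h
      · exact hyR h.symm
  · have hlen : dist (r : Plane) y ≤ 3 * β := by
      refine dist_le_max_of_mem_triangle hyt ?_ (dist_le_three_mul hβ hcr.symm hcg hgx)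
      have := hβ r c hcr.symm
      have : (0 : ℝ) ≤ dist (r : Plane) c := dist_nonneg
      linarith
    rintro a b (h | h | h)
    · exact Or.inl (layer_dist_le hβ h)
    · exact Or.inl (layer_dist_le hβ h)
    · right
      rcases ((SimpleGraph.edge_adj _ _ _ _).1 h).1 with ⟨rfl, rfl⟩ | ⟨rfl, rfl⟩
      · exact ⟨rfl, hlen⟩
      · exact ⟨Sym2.eq_swap, by rwa [dist_comm]⟩

/-- Compare distances to the line $xr$: each of $c$ and $g$ would be no farther from it than the
other, forcing $c=g$ and contradicting nondegeneracy. -/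
lemma not_mem_triangle_of_mem {r g x c : Plane} (hc : c ∈ triangle r g x)
    (hrgx : orient x r g ≠ 0) (hrgc : orient r g c ≠ 0) : g ∉ triangle r c x := by
  intro hg
  obtain ⟨α, β, γ, hα, hβ, hγ, hs, ho⟩ := orient_of_mem_triangle hc
  obtain ⟨α', β', γ', hα', hβ', hγ', hs', ho'⟩ := orient_of_mem_triangle hg
  have e1 := ho x r
  have e2 := ho' x r
  simp only [orient_self_outer, orient_self_right, mul_zero, add_zero, zero_add] at e1 e2
  rw [e1] at e2
  have e3 : β' * β = 1 := mul_right_cancel₀ hrgx (by linarith)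
  have hβ1 : β = 1 := by nlinarith
  have hα0 : α = 0 := by linarith
  have hγ0 : γ = 0 := by linarith
  apply hrgc
  rw [ho r g]
  simp [hα0, hγ0]

/-- A leaf `r` at a vertex `c` of degree two whose other neighbour `g` has all its other neighbours
on the other side of the line `c g`. -/
lemma hasLayerPair_of_opposite_turn (hgen : GeneralPosition S) {M : SimpleGraph S} (hT : M.IsTree)
    (hL : LuneFree M) {β : ℝ} (hβ : ∀ a b : S, M.Adj a b → dist (a : Plane) b ≤ β)
    {r c g x : S} (hr : ∀ u, M.Adj r u → u = c) (hcr : M.Adj c r) (hcg : M.Adj c g) (hrg : r ≠ g)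
    (hc : ∀ u, M.Adj c u → u = r ∨ u = g) (hcx : Gap M g c x)
    (hside : ∀ u, M.Adj g u → u ≠ c → orient (c : Plane) g r * orient (c : Plane) g u < 0) :
    HasLayerPair S β := by
  have hgap : Gap M c r g := ⟨hcr, hcg, hrg, fun w hw => by
    rcases hc w hw with rfl | rfl
    · exact not_inWedge_self_left _ _ _
    · exact not_inWedge_self_right _ _ _⟩
  have hgx : M.Adj g x := hcx.2.1
  have hcx' : c ≠ x := hcx.2.2.1
  have dc : M.dist r c = 1 := SimpleGraph.dist_eq_one_iff_adj.2 hcr.symm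
  have dg : M.dist r g = 2 := dist_eq_two hT hcr.symm hcg hrg.symm
  have dx : M.dist r x % 2 = 1 := by
    have := dist_parity hT r hgx
    omega
  have hrx : r ≠ x := by rintro rfl; simp at dx
  have edge_iff : ∀ {u v : S}, u ≠ v → ∀ {a b : S}, (SimpleGraph.edge u v).Adj a b ↔
      (a = u ∧ b = v ∨ a = v ∧ b = u) := by
    intro u v huv a b
    rw [SimpleGraph.edge_adj]
    constructor
    · exact fun h => h.1
    · rintro (⟨rfl, rfl⟩ | ⟨rfl, rfl⟩)
      · exact ⟨Or.inl ⟨rfl, rfl⟩, huv⟩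
      · exact ⟨Or.inr ⟨rfl, rfl⟩, huv.symm⟩
  -- The gap $rg$ and the tree edge $cg$ change layers. `R` stays connected through $r\,c\,g$; in
  -- `B₀` the edge $rg$ is a component of its own, still to be joined to the rest.
  set R := (layer M r 0 \ SimpleGraph.edge r g) ⊔ SimpleGraph.edge c g with hR
  set B₀ := (layer M r 1 \ SimpleGraph.edge c g) ⊔ SimpleGraph.edge r g with hB₀
  have hB₀adj : ∀ {a b}, B₀.Adj a b ↔ ((layer M r 1).Adj a b ∧
      ¬ (a = c ∧ b = g ∨ a = g ∧ b = c)) ∨ (a = r ∧ b = g ∨ a = g ∧ b = r) := by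
    intro a b
    rw [hB₀, SimpleGraph.sup_adj, SimpleGraph.sdiff_adj, edge_iff hcg.ne, edge_iff hrg]
  have hRadj : ∀ {a b}, R.Adj a b ↔ ((layer M r 0).Adj a b ∧
      ¬ (a = r ∧ b = g ∨ a = g ∧ b = r)) ∨ (a = c ∧ b = g ∨ a = g ∧ b = c) := by
    intro a b
    rw [hR, SimpleGraph.sup_adj, SimpleGraph.sdiff_adj, edge_iff hrg, edge_iff hcg.ne]
  have hB₀layer : ∀ {a b}, B₀.Adj a b → a ≠ r → b ≠ r → (layer M r 1).Adj a b := by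
    intro a b hab ha hb
    rcases hB₀adj.1 hab with h | ⟨h, -⟩ | ⟨-, h⟩
    · exact h.1
    · exact absurd h ha
    · exact absurd h hb
  have hRnc : NonCrossing R :=
    NonCrossing.sup_edge ((layer_nonCrossing hgen hT hL r 0).mono sdiff_le)
      fun a b hab h1 h2 h3 h4 => layer_disjoint_edge hgen hL hab.1 hcg h1 h2 h3 h4
  have hB₀nc : NonCrossing B₀ := by
    refine NonCrossing.sup_edge ((layer_nonCrossing hgen hT hL r 1).mono sdiff_le) ?_
    rintro a b ⟨hab, -⟩ har hag hbr hbg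
    rcases layer_adj.1 hab with ⟨h, -⟩ | ⟨w, hw, hg⟩
    · exact (hgap.disjoint_edge hgen hL h har.symm hbr.symm hag.symm hbg.symm).symm
    by_cases hwg : w = g
    · subst hwg
      -- A gap around $g$ could cross $rg$ only if it ends at $c$, but its other end then lies
      -- across the line $cg$ from $r$.
      have key : ∀ u, M.Adj w u → u ≠ c → u ≠ r →
          Disjoint (segment ℝ (c : Plane) u) (segment ℝ (r : Plane) w) := by
        intro u hwu huc hur
        by_contra hdis
        have hin : InWedge (c : Plane) r w u :=
          inWedge_of_meet (hgen.orient_ne hcr.ne hcg.ne hrg)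
            (hgen.orient_ne huc.symm hcg.ne hwu.ne.symm) (hgen.orient_ne hcr.ne huc.symm hur.symm)
            hdis
        have h1 := hin.symm.2
        have h2 := hside u hwu huc
        linarith
      by_cases hac : a = c
      · subst hac
        exact key b hg.2.1 hg.2.2.1.symm hbr
      by_cases hbc : b = c
      · subst hbc
        rw [segment_symm]
        exact key a hg.1 hg.2.2.1 har
      exact hg.disjoint_chord hgen hL hcr hcg hrg har hag hbr hbg hac hbc
    · refine (hgap.disjoint_chord hgen hL hg.1 hg.2.1 hg.2.2.1 har.symm hbr.symm hag.symm hbg.symm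
        ?_ (Ne.symm hwg)).symm
      rintro rfl
      exact hg.2.2.1 ((hr a hg.1).trans (hr b hg.2.1).symm)
  have hrgB₀ : B₀.Adj r g := hB₀adj.2 (Or.inr (Or.inl ⟨rfl, rfl⟩))
  have hcxB₀ : B₀.Adj c x := by
    refine hB₀adj.2 (Or.inl ⟨Or.inr ⟨g, by rw [dg]; decide, hcx⟩, ?_⟩)
    rintro (⟨-, h⟩ | ⟨h, -⟩)
    · exact hgx.ne h.symm
    · exact hcg.ne h
  have hβ0 : 0 ≤ β := dist_nonneg.trans (hβ _ _ hcr)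
  have hlrx : dist (r : Plane) x ≤ 3 * β := dist_le_three_mul hβ hcr.symm hcg hgx
  obtain ⟨y, hyr, hyc, hyg, hlen, hvis⟩ : ∃ y : S, y ≠ r ∧ y ≠ c ∧ y ≠ g ∧
      dist (r : Plane) y ≤ 3 * β ∧ ∀ a b, B₀.Adj a b → a ≠ r → b ≠ r → a ≠ y → b ≠ y →
        Disjoint (segment ℝ (a : Plane) b) (segment ℝ (r : Plane) y) := by
    obtain ⟨y, hyr, hyg, hyt, hvis⟩ := exists_visible hgen B₀ hrg hrx hgx.ne
      (fun a b hab ha hb ha' hb' => hB₀nc a b r g hab hrgB₀ ha ha' hb hb')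
      (fun a b hab har hbr ha hb ha' hb' =>
        layer_disjoint_edge hgen hL (hB₀layer hab har hbr) hgx ha ha' hb hb')
      (by
        intro b hab hbr
        exfalso
        rcases hB₀adj.1 hab with ⟨⟨h, he⟩ | ⟨w, hw, hg⟩, hn⟩ | ⟨h, -⟩ | ⟨-, h⟩
        · have hb1 : M.dist r b ≠ 1 := fun h1 =>
            hn (Or.inr ⟨rfl, hr b (SimpleGraph.dist_eq_one_iff_adj.1 h1)⟩)
          rw [Nat.even_iff] at he
          rcases hT.dist_eq_dist_add_one_of_adj r h with h2 | h2 <;> omega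
        · have := hg.parity hT r
          rw [Nat.odd_iff] at hw
          omega
        · exact hrg h.symm
        · exact hbr h)
    -- The edge $rc$ is already used in `R`. If $c$ is the visible point, look again in the triangle
    -- $rcx$, which does not contain $g$ since $c$ lies in the triangle $rgx$.
    by_cases hyc : y = c
    · subst hyc
      obtain ⟨y', hyr', hyc', hyt', hvis'⟩ := exists_visible hgen B₀ hyr.symm hrx hcx'
        (fun a b hab ha hb ha' hb' =>
          layer_disjoint_edge hgen hL (hB₀layer hab ha hb) hcr.symm ha ha' hb hb')
        (fun a b hab _ _ ha hb ha' hb' => hB₀nc a b y x hab hcxB₀ ha ha' hb hb')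
        (by
          intro b hab hbr
          left
          rcases hB₀adj.1 hab with ⟨⟨h, -⟩ | ⟨w, hw, hg⟩, hn⟩ | ⟨h, -⟩ | ⟨h, -⟩
          · rcases hc b h with rfl | rfl
            · exact absurd rfl hbr
            · exact absurd (Or.inl ⟨rfl, rfl⟩) hn
          · rcases hc w hg.1.symm with rfl | rfl
            · exact absurd (hr b hg.2.1).symm hg.2.2.1
            · refine hcx.eq_of_same_side hgen hg ?_
              have h1 := hside x hgx hcx'.symm
              have h2 := hside b hg.2.1 hg.2.2.1.symm
              have h3 : 0 < orient (y : Plane) w r * orient (y : Plane) w r :=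
                mul_self_pos.2 (hgen.orient_ne hcg.ne hcr.ne hrg.symm)
              have h4 := mul_pos_of_neg_of_neg h1 h2
              refine pos_of_mul_pos_left (b := orient (y : Plane) w r * orient (y : Plane) w r)
                ?_ h3.le
              linarith
          · exact absurd h hyr
          · exact absurd h hcg.ne)
      refine ⟨y', hyr', hyc', ?_, dist_le_max_of_mem_triangle hyt' ?_ hlrx, hvis'⟩
      · rintro rfl
        exact not_mem_triangle_of_mem hyt (hgen.orient_ne hrx.symm hgx.ne.symm hrg)
          (hgen.orient_ne hrg hyr.symm hyg.symm) hyt'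
      · have := hβ r y hcr.symm
        linarith
    · refine ⟨y, hyr, hyc, hyg, dist_le_max_of_mem_triangle hyt ?_ hlrx, hvis⟩
      have := dist_le_two_mul hβ hcr hcg
      linarith
  refine ⟨R, B₀ ⊔ SimpleGraph.edge r y, ?_, ?_, hRnc, ?_, ?_, s(r, y), ?_⟩
  · have hrc : R.Adj r c := by
      refine hRadj.2 (Or.inl ⟨Or.inl ⟨hcr.symm, by simp [dc]⟩, ?_⟩)
      rintro (⟨-, h⟩ | ⟨h, -⟩)
      · exact hcg.ne h
      · exact hrg h
    have hcgR : R.Adj c g := hRadj.2 (Or.inr (Or.inl ⟨rfl, rfl⟩))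
    have hreach : R.Reachable r g := hrc.reachable.trans hcgR.reachable
    have hRlayer : ∀ a b, (layer M r 0).Adj a b → R.Reachable a b := by
      intro a b hab
      by_cases he : a = r ∧ b = g ∨ a = g ∧ b = r
      · rcases he with ⟨rfl, rfl⟩ | ⟨rfl, rfl⟩
        · exact hreach
        · exact hreach.symm
      · exact SimpleGraph.Adj.reachable (hRadj.2 (Or.inl ⟨hab, he⟩))
    refine connected_of_reachable r (reachable_root hT ?_ ?_)
    · exact fun v a b hv hg => hRlayer a b (Or.inr ⟨v, by simpa using hv, hg⟩)
    · refine fun v p hp hd ho => hRlayer v p (Or.inl ⟨hp.symm, ?_⟩)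
      rw [Nat.odd_iff] at ho
      rw [Nat.even_iff, hd]
      omega
  · have hle : B₀ ≤ B₀ ⊔ SimpleGraph.edge r y := le_sup_left
    have key : ∀ v, v ≠ r → v ≠ g → (B₀ ⊔ SimpleGraph.edge r y).Reachable v c := fun v hv hvg =>
      -- The vertex $g$ is exempted because its parent edge $cg$ was removed; it is reached through
      -- $r$ instead.
      reachable_center hT hr (P := fun v => v ≠ g)
        (fun v a b hv hg => by
          refine SimpleGraph.Adj.reachable (hle (hB₀adj.2 (Or.inl
            ⟨Or.inr ⟨v, hv.add_one, hg⟩, ?_⟩)))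
          have hpar := hg.parity hT r
          rw [Nat.even_iff] at hv
          rintro (⟨-, rfl⟩ | ⟨rfl, -⟩) <;> omega)
        (fun v p hvg hp hd he => by
          rw [Nat.even_iff] at he
          refine SimpleGraph.Adj.reachable (hle (hB₀adj.2 (Or.inl ⟨Or.inl ⟨hp.symm, ?_⟩, ?_⟩)))
          · rw [Nat.even_iff]
            omega
          · rintro (⟨rfl, -⟩ | ⟨h, -⟩)
            · omega
            · exact hvg h) v hv (fun _ => hvg)
    have hry : (B₀ ⊔ SimpleGraph.edge r y).Reachable r c :=
      SimpleGraph.Reachable.trans (SimpleGraph.Adj.reachable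
        (Or.inr ((edge_iff hyr.symm).2 (Or.inl ⟨rfl, rfl⟩)))) (key y hyr hyg)
    refine connected_of_reachable c fun v => ?_
    by_cases hv : v = r
    · rw [hv]; exact hry
    by_cases hvg : v = g
    · rw [hvg]; exact (hle hrgB₀).symm.reachable.trans hry
    exact key v hv hvg
  · exact NonCrossing.sup_edge hB₀nc
      fun a b hab har hay hbr hby => hvis a b hab har hbr hay hby
  · have hyR : ¬ R.Adj r y := by
      intro h
      rcases hRadj.1 h with ⟨⟨h, -⟩ | ⟨w, -, hg⟩, -⟩ | ⟨h, -⟩ | ⟨h, -⟩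
      · exact hyc (hr y h)
      · obtain rfl := hr w hg.1.symm
        exact (hc y hg.2.1).elim hyr hyg
      · exact hcr.ne h.symm
      · exact hrg h
    rintro a b h (h' | h')
    · rcases hRadj.1 h with ⟨h1, h2⟩ | h1 <;> rcases hB₀adj.1 h' with ⟨g1, g2⟩ | g1
      · exact layers_disjoint hT h1 g1
      · exact h2 g1
      · exact g2 h1
      · rcases h1 with ⟨rfl, rfl⟩ | ⟨rfl, rfl⟩ <;> rcases g1 with ⟨e1, e2⟩ | ⟨e1, e2⟩
        · exact hcr.ne e1
        · exact hcg.ne e1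
        · exact hcg.ne e2
        · exact hcr.ne e2
    · rcases (edge_iff hyr.symm).1 h' with ⟨rfl, rfl⟩ | ⟨rfl, rfl⟩
      · exact hyR h
      · exact hyR h.symm
  · rintro a b (h | h | h)
    · left
      rcases hRadj.1 h with ⟨h, -⟩ | h
      · exact layer_dist_le hβ h
      · have : dist (c : Plane) g ≤ 2 * β := by linarith [hβ c g hcg]
        rcases h with ⟨rfl, rfl⟩ | ⟨rfl, rfl⟩
        · exact this
        · rwa [dist_comm]
    · left
      rcases hB₀adj.1 h with ⟨h, -⟩ | ⟨rfl, rfl⟩ | ⟨rfl, rfl⟩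
      · exact layer_dist_le hβ h
      · exact dist_le_two_mul hβ hcr hcg
      · exact dist_le_two_mul hβ hcg hcr
    · right
      rcases (edge_iff hyr.symm).1 h with ⟨rfl, rfl⟩ | ⟨rfl, rfl⟩
      · exact ⟨rfl, hlen⟩
      · exact ⟨Sym2.eq_swap, by rwa [dist_comm]⟩

/-- If some neighbour of `g` lies on the same side of the edge `c g` as `s`, then there is a gap
from `c` on that side. -/
lemma exists_gap_same_side {M : SimpleGraph S} {c g : S} (hcg : M.Adj c g)
    {s : Plane} (hex : ∃ u, M.Adj g u ∧ 0 < orient (c : Plane) g s * orient (c : Plane) g u) :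
    ∃ x, Gap M g c x ∧ 0 < orient (c : Plane) g s * orient (c : Plane) g x := by
  obtain ⟨x, ⟨hx, hxs⟩, hmin⟩ := exists_no_inWedge (g : Plane) c
    (fun u : S => M.Adj g u ∧ 0 < orient (c : Plane) g s * orient (c : Plane) g u) hex
  have hcx : c ≠ x := by rintro rfl; simp at hxs
  refine ⟨x, ⟨hcg.symm, hx, hcx, fun w hw hin => hmin w ⟨hw, ?_⟩ hin⟩, hxs⟩
  have e : ∀ w : Plane, orient (g : Plane) c w = - orient (c : Plane) g w := by
    intro w; unfold orient; ring
  have h := hin.2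
  rw [e, e] at h
  have h1 : 0 < orient (c : Plane) g x * orient (c : Plane) g x :=
    mul_self_pos.2 (right_ne_zero_of_mul hxs.ne')
  refine pos_of_mul_pos_left (b := orient (c : Plane) g x * orient (c : Plane) g x) ?_ h1.le
  have := mul_pos hxs h
  linarith

/-- A convex wedge of neighbours of `c` that contains a neighbour can be shrunk until it contains
exactly one. -/
lemma exists_wedge_unique (hgen : GeneralPosition S) {M : SimpleGraph S} {c a b w : S}
    (ha : M.Adj c a) (hb : M.Adj c b) (hw : M.Adj c w) (hin : InWedge (c : Plane) a b w) :
    ∃ a b w, M.Adj c a ∧ M.Adj c b ∧ M.Adj c w ∧ InWedge (c : Plane) a b w ∧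
      ∀ u, M.Adj c u → InWedge (c : Plane) a b u → u = w := by
  classical
  induction hn : (Finset.univ.filter fun w : S => M.Adj c w ∧ InWedge (c : Plane) a b w).card
    using Nat.strong_induction_on generalizing a b w with
  | _ n ih =>
    by_cases huniq : ∀ u, M.Adj c u → InWedge (c : Plane) a b u → u = w
    · exact ⟨a, b, w, ha, hb, hw, hin, huniq⟩
    · push Not at huniq
      obtain ⟨u, hu, hui, huw⟩ := huniq
      rcases inWedge_or_of_inWedge hin hui (hgen.orient_ne hw.ne hu.ne huw.symm) with h | h
      · refine ih _ ?_ ha hw hu h rfl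
        rw [← hn]
        refine Finset.card_lt_card (Finset.ssubset_iff_of_subset ?_ |>.2 ⟨w, ?_, ?_⟩)
        · intro v hv
          simp only [Finset.mem_filter, Finset.mem_univ, true_and] at hv ⊢
          exact ⟨hv.1, hin.trans hv.2⟩
        · simp [hw, hin]
        · simp [not_inWedge_self_right]
      · refine ih _ ?_ hw hb hu h rfl
        rw [← hn]
        refine Finset.card_lt_card (Finset.ssubset_iff_of_subset ?_ |>.2 ⟨w, ?_, ?_⟩)
        · intro v hv
          simp only [Finset.mem_filter, Finset.mem_univ, true_and] at hv ⊢
          exact ⟨hv.1, (hin.symm.trans hv.2.symm).symm⟩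
        · simp [hw, hin]
        · simp [not_inWedge_self_left]

lemma InWedge.left_gap {M : SimpleGraph S} {c a b w : S} (ha : M.Adj c a)
    (hw : M.Adj c w) (hin : InWedge (c : Plane) a b w)
    (huniq : ∀ u, M.Adj c u → InWedge (c : Plane) a b u → u = w) : Gap M c a w := by
  refine ⟨ha, hw, ?_, fun u hu hui => ?_⟩
  · rintro rfl; exact not_inWedge_self_left _ _ _ hin
  · obtain rfl := huniq u hu (hin.trans hui)
    exact not_inWedge_self_right _ _ _ hui

/-- A neighbour `w` of `c` that is angularly between `a` and `b`. -/
lemma hasLayerPair_of_wedge (hgen : GeneralPosition S) {M : SimpleGraph S} (hT : M.IsTree)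
    (hL : LuneFree M) {β : ℝ} (hβ : ∀ a b : S, M.Adj a b → dist (a : Plane) b ≤ β)
    {c a b w : S} (ha : M.Adj c a) (hb : M.Adj c b) (hw : M.Adj c w)
    (hin : InWedge (c : Plane) a b w)
    (huniq : ∀ u, M.Adj c u → InWedge (c : Plane) a b u → u = w)
    (hone : ∀ h h', M.Adj c h → M.Adj c h' → ¬ (∀ u, M.Adj h u → u = c) →
        ¬ (∀ u, M.Adj h' u → u = c) → h = h') : HasLayerPair S β := by
  have gaw : Gap M c a w := InWedge.left_gap ha hw hin huniq
  have huniq' : ∀ u, M.Adj c u → InWedge (c : Plane) b a u → u = w :=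
    fun u hu hui => huniq u hu hui.symm
  have gbw : Gap M c b w := InWedge.left_gap hb hw hin.symm huniq'
  have hab : a ≠ b := by
    rintro rfl
    have := hin.1
    simp at this
  by_cases hlw : ∀ u, M.Adj w u → u = c
  · by_cases hla : ∀ u, M.Adj a u → u = c
    · exact hasLayerPair_of_two_leaves hgen hT hL hβ hla hlw gaw gbw.symm hab huniq
    · have hlb : ∀ u, M.Adj b u → u = c := by
        by_contra hlb
        exact hab (hone a b ha hb hla hlb)
      exact hasLayerPair_of_two_leaves hgen hT hL hβ hlb hlw gbw gaw.symm hab.symm huniq'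
  · have hleaf : ∀ h, M.Adj c h → h ≠ w → ∀ u, M.Adj h u → u = c := by
      intro h hh hne
      by_contra hn
      exact hne (hone h w hh hw hn hlw)
    push Not at hlw
    obtain ⟨u, hu, huc⟩ := hlw
    have hopp : orient (c : Plane) w a * orient (c : Plane) w b < 0 := by
      rcases hin.pos_or_neg with ⟨-, h1, h2⟩ | ⟨-, h1, h2⟩ <;>
        rw [orient_swap (c : Plane) w a] at h2
      · exact mul_neg_of_neg_of_pos (by linarith) h1
      · exact mul_neg_of_pos_of_neg (by linarith) h1
    have hne : orient (c : Plane) w u ≠ 0 := hgen.orient_ne hw.ne huc.symm hu.ne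
    -- The leaves $a$ and $b$ lie on opposite sides of the line $cw$, so the further neighbour $u$
    -- of $w$ shares a side with one of them.
    have hcases : 0 < orient (c : Plane) w a * orient (c : Plane) w u ∨
        0 < orient (c : Plane) w b * orient (c : Plane) w u := by
      by_contra! hcon
      have h3 := mul_nonneg_of_nonpos_of_nonpos hcon.1 hcon.2
      have h4 := mul_pos_of_neg_of_neg hopp (neg_neg_of_pos (mul_self_pos.2 hne))
      linarith
    rcases hcases with h | h
    · obtain ⟨x, hx, hxs⟩ := exists_gap_same_side hw ⟨u, hu, h⟩
      exact hasLayerPair_of_same_turn hgen hT hL hβ (hleaf a ha gaw.2.2.1) gaw hx hxs hleaf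
    · obtain ⟨x, hx, hxs⟩ := exists_gap_same_side hw ⟨u, hu, h⟩
      exact hasLayerPair_of_same_turn hgen hT hL hβ (hleaf b hb gbw.2.2.1) gbw hx hxs hleaf

/-- Case split at the leaf cluster. If $c$ has degree two, the path $r\,c\,g$ continues because
$n\ge 4$, and its turn at $g$ decides. With more neighbours, either some wedge of neighbours
contains another one, or all pairs are gaps and two of any three neighbours are leaves. -/
lemma hasLayerPair (hgen : GeneralPosition S) (hcard : 4 ≤ S.card) {M : SimpleGraph S}
    (hT : M.IsTree) (hL : LuneFree M) {β : ℝ}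
    (hβ : ∀ a b : S, M.Adj a b → dist (a : Plane) b ≤ β) : HasLayerPair S β := by
  classical
  have hcardS : Fintype.card S = S.card := Fintype.card_coe S
  have : Nontrivial S := Fintype.one_lt_card_iff_nontrivial.1 (by omega)
  have hsmall : ∀ T : Finset S, T.card ≤ 3 → ∃ v, v ∉ T := by
    intro T hT3
    by_contra! hall
    have h1 : (Finset.univ : Finset S) ⊆ T := fun v _ => hall v
    have h2 := Finset.card_le_card h1
    rw [Finset.card_univ] at h2
    omega
  obtain ⟨c, r, hcr, hr, hone⟩ := exists_leaf_cluster hT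
  obtain ⟨g, hcg, hgr⟩ : ∃ g, M.Adj c g ∧ g ≠ r := by
    by_contra! hcon
    obtain ⟨v, hv⟩ := hsmall {r, c} (Finset.card_le_two.trans (by norm_num))
    refine hv (forall_of_connected hT.connected (P := fun v => v ∈ ({r, c} : Finset S))
      (a := r) (by simp) ?_ v)
    intro u v hu huv
    simp only [Finset.mem_insert, Finset.mem_singleton] at hu ⊢
    rcases hu with rfl | rfl
    · exact Or.inr (hr v huv)
    · exact Or.inl (hcon v huv)
  by_cases hdeg : ∀ u, M.Adj c u → u = r ∨ u = g
  · obtain ⟨u, hgu, huc⟩ : ∃ u, M.Adj g u ∧ u ≠ c := by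
      by_contra! hcon
      obtain ⟨v, hv⟩ := hsmall {r, c, g} Finset.card_le_three
      refine hv (forall_of_connected hT.connected
        (P := fun v => v ∈ ({r, c, g} : Finset S)) (a := r) (by simp) ?_ v)
      intro u v hu huv
      simp only [Finset.mem_insert, Finset.mem_singleton] at hu ⊢
      rcases hu with rfl | rfl | rfl
      · exact Or.inr (Or.inl (hr v huv))
      · rcases hdeg v huv with h | h
        · exact Or.inl h
        · exact Or.inr (Or.inr h)
      · exact Or.inr (Or.inl (hcon v huv))
    by_cases hex : ∃ u, M.Adj g u ∧ 0 < orient (c : Plane) g r * orient (c : Plane) g u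
    · obtain ⟨x, hx, hxs⟩ := exists_gap_same_side hcg hex
      have hgap : Gap M c r g := ⟨hcr, hcg, hgr.symm, fun w hw => by
        rcases hdeg w hw with rfl | rfl
        · exact not_inWedge_self_left _ _ _
        · exact not_inWedge_self_right _ _ _⟩
      refine hasLayerPair_of_same_turn hgen hT hL hβ hr hgap hx hxs ?_
      intro h hh hne
      obtain rfl := (hdeg h hh).resolve_right hne
      exact hr
    · push Not at hex
      have hside : ∀ u, M.Adj g u → u ≠ c → orient (c : Plane) g r * orient (c : Plane) g u < 0 :=
        fun u hu hne => (hex u hu).lt_of_ne (mul_ne_zero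
          (hgen.orient_ne hcg.ne hcr.ne hgr) (hgen.orient_ne hcg.ne hne.symm hu.ne))
      obtain ⟨x, hx, -⟩ := exists_gap_same_side (s := u) hcg
        ⟨u, hgu, mul_self_pos.2 (hgen.orient_ne hcg.ne huc.symm hgu.ne)⟩
      exact hasLayerPair_of_opposite_turn hgen hT hL hβ hr hcr hcg hgr.symm hdeg hx hside
  · push Not at hdeg
    obtain ⟨h, hch, hhr, hhg⟩ := hdeg
    by_cases hwedge : ∃ a b w, M.Adj c a ∧ M.Adj c b ∧ M.Adj c w ∧ InWedge (c : Plane) a b w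
    · obtain ⟨a, b, w, ha, hb, hw, hin⟩ := hwedge
      obtain ⟨a, b, w, ha, hb, hw, hin, huniq⟩ := exists_wedge_unique hgen ha hb hw hin
      exact hasLayerPair_of_wedge hgen hT hL hβ ha hb hw hin huniq hone
    · push Not at hwedge
      have hgap : ∀ a b, M.Adj c a → M.Adj c b → a ≠ b → Gap M c a b :=
        fun a b ha hb hab => ⟨ha, hb, hab, fun w hw => hwedge a b w ha hb hw⟩
      by_cases hlg : ∀ u, M.Adj g u → u = c
      · exact hasLayerPair_of_two_leaves hgen hT hL hβ hr hlg (hgap r g hcr hcg hgr.symm)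
          (hgap g h hcg hch hhg.symm) hhr.symm
          (fun w hw hin => absurd hin (hwedge r h w hcr hch hw))
      · have hlh : ∀ u, M.Adj h u → u = c := by
          by_contra hlh
          exact hhg (hone h g hch hcg hlh hlg)
        exact hasLayerPair_of_two_leaves hgen hT hL hβ hr hlh (hgap r h hcr hch hhr.symm)
          (hgap h g hch hcg hhg) hgr.symm
          (fun w hw hin => absurd hin (hwedge r g w hcr hcg hw))

/-! ### Bottleneck bounds and extraction of the spanning trees -/

lemma dist_le_bottleneck (M : SimpleGraph S) {a b : S} (h : M.Adj a b) :
    dist (a : Plane) b ≤ bottleneck M :=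
  le_csSup (Set.toFinite _).bddAbove ⟨s(a, b), h, rfl⟩

lemma bottleneck_le {G : SimpleGraph S} {K : ℝ} (hK : 0 ≤ K)
    (h : ∀ a b, G.Adj a b → dist (a : Plane) b ≤ K) : bottleneck G ≤ K := by
  refine Real.sSup_le ?_ hK
  rintro _ ⟨e, he, rfl⟩
  induction e with
  | _ a b => exact h a b he

lemma bottleneck_nonneg (M : SimpleGraph S) : 0 ≤ bottleneck M := by
  refine Real.sSup_nonneg ?_
  rintro _ ⟨e, -, rfl⟩
  exact edgeLength_nonneg e

end PlaneLayers

theorem mainTheorem2 (S : Finset PlaneLayers.Plane) (hcard : 4 ≤ S.card)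
    (hgen : PlaneLayers.GeneralPosition S)
    (M : SimpleGraph S) (hM : PlaneLayers.IsMST M) :
    ∃ R B : SimpleGraph S,
      R.IsTree ∧ PlaneLayers.IsPlane R ∧
      B.IsTree ∧ PlaneLayers.IsPlane B ∧
      Disjoint R.edgeSet B.edgeSet ∧
      max (PlaneLayers.bottleneck R) (PlaneLayers.bottleneck B) ≤
        3 * PlaneLayers.bottleneck M ∧
      {e : Sym2 S | e ∈ R.edgeSet ∪ B.edgeSet ∧
        2 * PlaneLayers.bottleneck M < PlaneLayers.edgeLength e}.Subsingleton := by
  open PlaneLayers in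
  obtain ⟨R', B', hR', hB', hRnc, hBnc, hdis, e, he⟩ :=
    hasLayerPair hgen hcard hM.1 hM.luneFree fun a b => dist_le_bottleneck M
  -- Planarity, disjointness and the length bounds pass to subgraphs, so any spanning trees of the
  -- two connected graphs serve.
  obtain ⟨R, hRle, hR⟩ := hR'.exists_isTree_le
  obtain ⟨B, hBle, hB⟩ := hB'.exists_isTree_le
  have hβ := PlaneLayers.bottleneck_nonneg M
  have h3 : ∀ a b, R'.Adj a b ∨ B'.Adj a b →
      dist (a : PlaneLayers.Plane) b ≤ 3 * PlaneLayers.bottleneck M := by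
    intro a b hab
    rcases he a b hab with h | h
    · linarith
    · exact h.2
  refine ⟨R, B, hR, (hRnc.mono hRle).isPlane hgen, hB, (hBnc.mono hBle).isPlane hgen, ?_, ?_, ?_⟩
  · rw [Set.disjoint_left]
    intro e
    induction e with
    | _ a b => exact fun h h' => hdis a b (hRle h) (hBle h')
  · exact max_le
      (PlaneLayers.bottleneck_le (by linarith) fun a b h => h3 a b (Or.inl (hRle h)))
      (PlaneLayers.bottleneck_le (by linarith) fun a b h => h3 a b (Or.inr (hBle h)))
  · have key : ∀ f : Sym2 S, f ∈ R.edgeSet ∪ B.edgeSet →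
        2 * PlaneLayers.bottleneck M < PlaneLayers.edgeLength f → f = e := by
      intro f
      induction f with
      | _ a b =>
        intro hf hlt
        rcases he a b (hf.imp (fun h => hRle h) (fun h => hBle h)) with h | h
        · exact absurd hlt (not_lt.2 h)
        · exact h.1
    intro f hf f' hf'
    rw [key f hf.1 hf.2, key f' hf'.1 hf'.2]
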